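/- Let $q$ be a prime power, let $n>1$ be an integer that is not a prime power, and let $1<k<\sigma_0(n)$, where $\sigma_0(n)$ is the number of positive divisors of $n$. For $d\mid m\mid n$ and $x\in\mathbb F_{q^m}$ write $\mathrm{Tr}_{m/d}(x)=\sum_{i=0}^{m/d-1}x^{q^{di}}$ for the trace of $x$ over $\mathbb F_{q^d}$; all fields $\mathbb F_{q^m}$ with $m\mid n$ are regarded as subfields of $\mathbb F_{q^n}$. Let $d_1<\dots<d_k<n$ be divisors of $n$ such that $d_i\nmid d_j$ for all $i\ne j$, and let $a_i\in\mathbb F_{q^{d_i}}$ $(1\le i\le k)$ be elements such that $$\mathrm{Tr}_{d_i/\gcd(d_i,d_j)}(a_i)=\mathrm{Tr}_{d_j/\gcd(d_i,d_j)}(a_j)\qquad\text{for all }1\le i<j\le k.$$ If $\mathrm{lcm}(d_1,\dots,d_k)<n$, then there exists a primitive element $\alpha\in\mathbb F_{q^n}$, that is, a generator of the multiplicative group $\mathbb F_{q^n}^*$, such that $\mathrm{Tr}_{n/d_i}(\alpha)=a_i$ for every $1\le i\le k$. -/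

import Mathlib

/-- `Tr_{m/d}(x) = ∑_{i=0}^{m/d-1} x^(q^(d i))`, the trace of an element `x` of the field with
`q ^ m` elements over its subfield with `q ^ d` elements, where `d ∣ m`. All fields with `q ^ m`
elements are taken inside one big field `L`, so the value is an element of `L`. -/
def traceSum {L : Type*} [Field L] (q m d : ℕ) (x : L) : L :=
  ∑ i ∈ Finset.range (m / d), x ^ (q ^ (d * i))

/-- An element of a field is primitive if it is a unit that generates the multiplicative group. -/
def IsPrimitiveElement {L : Type*} [Field L] (x : L) : Prop :=
  ∃ u : Lˣ, (u : L) = x ∧ ∀ v : Lˣ, v ∈ Subgroup.zpowers u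

/-- `Λ_k(n)`: the strictly increasing `k`-tuples of proper divisors of `n` none of which divides
another one. -/
def divisorTuples (k n : ℕ) : Set (Fin k → ℕ) :=
  {d | StrictMono d ∧ (∀ i, d i ∣ n ∧ d i < n) ∧ ∀ i j, i ≠ j → ¬ d i ∣ d j}

/-- Admissibility of a tuple `a`, where `a i` lies in the subfield of `L` with `q ^ (d i)`
elements: the traces of `a i` and `a j` over the subfield with `q ^ gcd (d i) (d j)` elements
coincide. -/
def IsAdmissible {L : Type*} [Field L] (q : ℕ) {k : ℕ} (d : Fin k → ℕ) (a : Fin k → L) : Prop :=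
  ∀ i j, i < j →
    traceSum q (d i) (Nat.gcd (d i) (d j)) (a i) = traceSum q (d j) (Nat.gcd (d i) (d j)) (a j)

/-! Since the least common multiple of the `d i` is below `n`, all the subfields `F i` lie in a
proper subfield `E` of `L`. The proof reduces the prescribed traces to one nonzero trace over `E`,
then finds a primitive element with that trace.

Reduction. The functionals `v ↦ Tr (a i * v)` on the `F i` agree on intersections, by admissibility.
Each `F i` is the kernel of `X ^ d i - 1` evaluated at Frobenius, and kernels of polynomials in one
endomorphism form a distributive lattice, so the functionals glue
(`exists_functional_of_compatible`). The sum of the `F i` does not contain `E`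
(`exists_mem_notMem_iSup_toSubmodule`), so the glued functional can be chosen nonzero on `E`. The
trace form represents it there by some `b ≠ 0`, and trace `b` over `E` forces every prescribed trace
(`exists_ne_zero_of_compatible_traces`).

Existence. On the fibre of a functional over `b ≠ 0`, a nontrivial multiplicative character sums to
at most the square root of the size of the fibre (`norm_fiber_sum_sq_le`). The Cohen–Huczynska sieve
turns this into a numerical criterion (`exists_isPrimitiveElement_of_sieve`). The degree of `E` has
two incomparable divisors, so it is not a prime power and is at least 6. Hence `E` has at least 64
elements and only a short list of small fields needs separate treatment. -/

/-! ### Character sums over the fibres of a linear functional -/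

open scoped ComplexConjugate in
theorem MulChar.apply_mul_conj_self {L : Type*} [Field L] [Finite L] (χ : MulChar L ℂ) {x : L}
    (hx : x ≠ 0) : χ x * conj (χ x) = 1 := by
  have h := χ.star_apply' x
  rw [starRingEnd_apply, h, ← MulChar.mul_apply, mul_inv_cancel, MulChar.one_apply hx.isUnit]

theorem MulChar.norm_apply_of_ne_zero {L : Type*} [Field L] [Finite L] (χ : MulChar L ℂ) {x : L}
    (hx : x ≠ 0) : ‖χ x‖ = 1 := by
  have h := χ.apply_mul_conj_self hx
  rw [Complex.mul_conj, Complex.normSq_eq_norm_sq] at h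
  have h2 : ‖χ x‖ ^ 2 = 1 := by exact_mod_cast h
  exact (pow_eq_one_iff_of_nonneg (norm_nonneg _) two_ne_zero).1 h2

section fiber

variable {E L : Type*} [Field E] [Field L] [Algebra E L] [Fintype L] [DecidableEq E]

theorem card_fiber_eq (T : L →ₗ[E] E) (hT : Function.Surjective T) (b c : E) :
    (Finset.univ.filter fun x => T x = b).card = (Finset.univ.filter fun x => T x = c).card := by
  obtain ⟨y, rfl⟩ := hT b
  obtain ⟨z, rfl⟩ := hT c
  refine Finset.card_bij (fun x _ => x - y + z) ?_ ?_ ?_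
  · intro x hx
    simp only [Finset.mem_filter, Finset.mem_univ, true_and] at hx ⊢
    simp [hx]
  · intro x _ x' _ h
    simpa using h
  · intro x hx
    simp only [Finset.mem_filter, Finset.mem_univ, true_and] at hx
    exact ⟨x - z + y, by simp [hx], by ring⟩

theorem card_fiber_mul_card [Fintype E] (T : L →ₗ[E] E) (hT : Function.Surjective T) (b : E) :
    (Finset.univ.filter fun x => T x = b).card * Fintype.card E = Fintype.card L := by
  have h := Finset.card_eq_sum_card_fiberwise (s := (Finset.univ : Finset L))
    (t := (Finset.univ : Finset E)) (f := T) (fun _ _ => Finset.mem_coe.2 (Finset.mem_univ _))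
  rw [Finset.card_univ] at h
  rw [h, Finset.sum_congr rfl fun c _ => card_fiber_eq T hT c b]
  simp [mul_comm]

theorem card_nonzero_map_mul_eq_zero [DecidableEq L] (T : L →ₗ[E] E) {c : L} (hc : c ≠ 0) :
    ((Finset.univ.filter fun x : L => x ≠ 0 ∧ T (x * c) = 0).card : ℂ)
      = (Finset.univ.filter fun x => T x = 0).card - 1 := by
  have h : (Finset.univ.filter fun x : L => x ≠ 0 ∧ T (x * c) = 0).card
      = ((Finset.univ.filter fun x => T x = 0).erase 0).card := by
    refine Finset.card_bij (fun x _ => x * c) ?_ ?_ ?_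
    · intro x hx
      simp only [Finset.mem_filter, Finset.mem_univ, true_and] at hx
      simp [hx.1, hx.2, hc]
    · intro x _ x' _ h
      exact mul_right_cancel₀ hc h
    · intro x hx
      simp only [Finset.mem_erase, Finset.mem_filter, Finset.mem_univ, true_and] at hx
      exact ⟨x * c⁻¹, by simp [hx.1, hx.2, hc], by simp [hc]⟩
  have h0 : (0 : L) ∈ Finset.univ.filter fun x => T x = 0 := by simp
  have h1 : 1 ≤ (Finset.univ.filter fun x => T x = 0).card :=
    Finset.card_pos.2 ⟨_, h0⟩
  rw [h, Finset.card_erase_of_mem h0]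
  push_cast [h1]
  ring

-- Expanding gives a sum over pairs with `T x = T y`. The substitution `x ↦ y * x` turns the
-- condition into `T (y * (x - 1)) = 0`, satisfied by `|ker T| - 1` nonzero `y` when `x ≠ 1` and by
-- all of them when `x = 1`. Since `χ` sums to zero, only the excess at `x = 1` survives.
open scoped ComplexConjugate in
theorem sum_norm_sq_fiber_sum [Fintype E] [DecidableEq L] (T : L →ₗ[E] E) {χ : MulChar L ℂ} (hχ : χ ≠ 1) :
    ∑ b, (∑ x with T x = b, χ x) * conj (∑ x with T x = b, χ x)
      = (Fintype.card L : ℂ) - (Finset.univ.filter fun x => T x = 0).card := by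
  have h1 : ∀ b, (∑ x with T x = b, χ x) * conj (∑ x with T x = b, χ x)
      = ∑ x, ∑ y, if T x = b ∧ T y = b then χ x * conj (χ y) else 0 := by
    intro b
    rw [map_sum, Finset.sum_mul_sum, Finset.sum_filter]
    refine Finset.sum_congr rfl fun x _ => ?_
    rw [Finset.sum_filter]
    split_ifs with h <;> simp [h]
  have h2 : ∑ b, (∑ x with T x = b, χ x) * conj (∑ x with T x = b, χ x)
      = ∑ y, ∑ x, if T x = T y then χ x * conj (χ y) else 0 := by
    rw [Finset.sum_congr rfl fun b _ => h1 b, Finset.sum_comm,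
      Finset.sum_congr rfl fun x _ => Finset.sum_comm, Finset.sum_comm]
    refine Finset.sum_congr rfl fun y _ => Finset.sum_congr rfl fun x _ => ?_
    simp only [ite_and, Finset.sum_ite_eq, Finset.mem_univ, if_true]
    exact if_congr eq_comm rfl rfl
  have h3 : ∀ y, (∑ x, if T x = T y then χ x * conj (χ y) else 0)
      = ∑ x, if y ≠ 0 ∧ T (y * (x - 1)) = 0 then χ x else 0 := by
    intro y
    by_cases hy : y = 0
    · simp [hy, MulChar.map_zero]
    · rw [← Equiv.sum_comp (Equiv.mulLeft₀ y hy)]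
      refine Finset.sum_congr rfl fun x _ => ?_
      have : T (y * x) = T y ↔ T (y * (x - 1)) = 0 := by
        rw [mul_sub, map_sub, mul_one, sub_eq_zero]
      simp only [Equiv.mulLeft₀_apply, this, hy, ne_eq, not_false_eq_true, true_and, map_mul]
      congr 1
      rw [mul_right_comm, χ.apply_mul_conj_self hy, one_mul]
  have h4 : ∀ x, (∑ y : L, if y ≠ 0 ∧ T (y * (x - 1)) = 0 then χ x else 0)
      = χ x * ((Finset.univ.filter fun x => T x = 0).card - 1)
        + if x = 1 then (Fintype.card L : ℂ) - (Finset.univ.filter fun x => T x = 0).card else 0 := by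
    intro x
    rw [← Finset.sum_filter, Finset.sum_const, nsmul_eq_mul]
    by_cases hx : x = 1
    · subst hx
      have : (Finset.univ.filter fun y : L => y ≠ 0 ∧ T (y * (1 - 1)) = 0)
          = Finset.univ.erase 0 := by ext; simp
      rw [this, Finset.card_erase_of_mem (Finset.mem_univ _), Finset.card_univ,
        Nat.cast_sub Fintype.card_pos]
      simp
    · rw [card_nonzero_map_mul_eq_zero T (sub_ne_zero.2 hx)]
      simp [hx, mul_comm]
  rw [h2, Finset.sum_congr rfl fun y _ => h3 y, Finset.sum_comm,
    Finset.sum_congr rfl fun x _ => h4 x, Finset.sum_add_distrib, ← Finset.sum_mul,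
    MulChar.sum_eq_zero_of_ne_one hχ]
  simp

/-- Multiplication by the scalar `c / b` carries one fibre to the other and changes the sum by a
factor of norm one. -/
theorem norm_fiber_sum_eq (T : L →ₗ[E] E) (χ : MulChar L ℂ) {b c : E} (hb : b ≠ 0) (hc : c ≠ 0) :
    ‖∑ x with T x = b, χ x‖ = ‖∑ x with T x = c, χ x‖ := by
  have hu : algebraMap E L (c / b) ≠ 0 := by simp [hb, hc]
  have : ∑ x with T x = c, χ x = χ (algebraMap E L (c / b)) * ∑ x with T x = b, χ x := by
    rw [Finset.mul_sum]
    symm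
    refine Finset.sum_bij (fun x _ => algebraMap E L (c / b) * x) ?_ ?_ ?_ ?_
    · intro x hx
      simp only [Finset.mem_filter, Finset.mem_univ, true_and] at hx ⊢
      rw [← Algebra.smul_def, map_smul, hx, smul_eq_mul, div_mul_cancel₀ _ hb]
    · intro x _ x' _ h
      exact mul_left_cancel₀ hu h
    · intro x hx
      simp only [Finset.mem_filter, Finset.mem_univ, true_and] at hx
      refine ⟨(b / c) • x, by simp [hx, hc], ?_⟩
      rw [← Algebra.smul_def, smul_smul]
      simp [hb, hc]
    · intro x _
      rw [map_mul]
  rw [this, norm_mul, χ.norm_apply_of_ne_zero hu, one_mul]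

/-- A nontrivial multiplicative character sums to at most the square root of the number of points
on an affine hyperplane that avoids the origin. -/
theorem norm_fiber_sum_sq_le [Fintype E] (T : L →ₗ[E] E) (hT : Function.Surjective T) {χ : MulChar L ℂ}
    (hχ : χ ≠ 1) {b : E} (hb : b ≠ 0) :
    ‖∑ x with T x = b, χ x‖ ^ 2 ≤ (Finset.univ.filter fun x => T x = b).card := by
  classical
  have h1 := sum_norm_sq_fiber_sum T hχ
  have h2 : ∑ c, ‖∑ x with T x = c, χ x‖ ^ 2
      = (Fintype.card L : ℝ) - (Finset.univ.filter fun x => T x = 0).card := by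
    simp_rw [Complex.mul_conj, Complex.normSq_eq_norm_sq] at h1
    exact_mod_cast h1
  rw [card_fiber_eq T hT 0 b, ← card_fiber_mul_card T hT b] at h2
  have h3 : ∑ c ∈ Finset.univ.erase (0 : E), ‖∑ x with T x = c, χ x‖ ^ 2
      = (Fintype.card E - 1 : ℝ) * ‖∑ x with T x = b, χ x‖ ^ 2 := by
    rw [Finset.sum_congr rfl fun c hc => by
      rw [norm_fiber_sum_eq T χ (Finset.ne_of_mem_erase hc) hb], Finset.sum_const, nsmul_eq_mul,
      Finset.card_erase_of_mem (Finset.mem_univ _), Finset.card_univ,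
      Nat.cast_sub Fintype.card_pos, Nat.cast_one]
  have h4 := Finset.add_sum_erase Finset.univ (fun c => ‖∑ x with T x = c, χ x‖ ^ 2)
    (Finset.mem_univ (0 : E))
  have h5 : (1 : ℝ) < Fintype.card E := by exact_mod_cast Fintype.one_lt_card
  -- The `|E| - 1` nonzero fibres contribute equally to the second moment; the term of the zero
  -- fibre is nonnegative and is dropped.
  have h6 : (Fintype.card E - 1 : ℝ) * ‖∑ x with T x = b, χ x‖ ^ 2
      ≤ (Fintype.card E - 1 : ℝ) * (Finset.univ.filter fun x => T x = b).card := by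
    push_cast at h2
    nlinarith [sq_nonneg ‖∑ x with T x = (0 : E), χ x‖]
  exact le_of_mul_le_mul_left h6 (by linarith)

end fiber

/-! ### The prime sieve with characters of prime order -/

theorem MulChar.sum_range_pow_apply {L : Type*} [Field L] (ψ : MulChar L ℂ) {p : ℕ}
    (hψ : orderOf ψ = p) (hp : p.Prime) {x : L} (hx : x ≠ 0) :
    ∑ j ∈ Finset.range p, (ψ x) ^ j = if ψ x = 1 then (p : ℂ) else 0 := by
  split_ifs with h
  · simp [h]
  · have h1 : ψ x ^ p = 1 := by
      rw [← MulChar.pow_apply' ψ hp.ne_zero, ← hψ, pow_orderOf_eq_one, MulChar.one_apply hx.isUnit]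
    rw [geom_sum_eq h, h1, sub_self, zero_div]

section sieve

open Classical in
/-- The elements of `A` on which none of the characters `ψ p`, `p ∈ P`, takes the value `1`. -/
noncomputable def freePart {L : Type*} [Field L] (A : Finset L) (ψ : ℕ → MulChar L ℂ)
    (P : Finset ℕ) : Finset L :=
  A.filter fun x => ∀ p ∈ P, ψ p x ≠ 1

variable {L : Type*} [Field L] {A : Finset L} {ψ : ℕ → MulChar L ℂ}

theorem freePart_empty : freePart A ψ ∅ = A := by simp [freePart]

theorem freePart_subset (P : Finset ℕ) : freePart A ψ P ⊆ A := Finset.filter_subset _ _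

open Classical in
theorem freePart_insert (p : ℕ) (P : Finset ℕ) :
    freePart A ψ (insert p P) = (freePart A ψ P).filter fun x => ψ p x ≠ 1 := by
  ext x
  simp only [freePart, Finset.mem_filter, Finset.forall_mem_insert]
  tauto

-- The indicator of `ψ p x = 1` is the average of the powers `ψ p x ^ j` over `j < p`.
open Classical in
theorem sum_freePart_filter_eq_one (hA : (0 : L) ∉ A) (P : Finset ℕ) {p : ℕ} (hp : p.Prime)
    (hψ : orderOf (ψ p) = p) (χ : MulChar L ℂ) :
    ∑ x ∈ freePart A ψ P with ψ p x = 1, χ x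
      = (p : ℂ)⁻¹ * ∑ j ∈ Finset.range p, ∑ x ∈ freePart A ψ P, (χ * ψ p ^ j) x := by
  rw [Finset.sum_comm, Finset.mul_sum, Finset.sum_filter]
  refine Finset.sum_congr rfl fun x hx => ?_
  have hx0 : x ≠ 0 := fun h => hA (h ▸ freePart_subset P hx)
  have hp0 : (p : ℂ) ≠ 0 := by exact_mod_cast hp.ne_zero
  have : ∀ j, (χ * ψ p ^ j) x = χ x * ψ p x ^ j := by
    intro j
    rw [MulChar.mul_apply]
    rcases j with _ | j
    · simp [MulChar.one_apply hx0.isUnit]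
    · rw [MulChar.pow_apply' _ (Nat.succ_ne_zero j)]
  simp_rw [this]
  rw [← Finset.mul_sum, MulChar.sum_range_pow_apply _ hψ hp hx0]
  split_ifs <;> field_simp
  simp

theorem mul_pow_ne_one_of_not_dvd_orderOf {G : Type*} [CommGroup G] {χ ψ : G} {p j : ℕ}
    (hp : p.Prime) (hψ : orderOf ψ = p) (hχ : ¬ p ∣ orderOf χ) (hj : 0 < j) (hjp : j < p) :
    χ * ψ ^ j ≠ 1 := by
  intro h
  have h1 : orderOf χ = orderOf (ψ ^ j) := by
    rw [eq_inv_of_mul_eq_one_left h, orderOf_inv]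
  have h2 : orderOf (ψ ^ j) = p := by
    rw [orderOf_pow' ψ hj.ne', hψ, Nat.Coprime.gcd_eq_one, Nat.div_one]
    exact (Nat.Prime.coprime_iff_not_dvd hp).2 (Nat.not_dvd_of_pos_of_lt hj hjp)
  exact hχ (by rw [h1, h2])

theorem not_dvd_orderOf_mul_pow {G : Type*} [CommGroup G] {χ ψ : G} {p r j : ℕ}
    (hp : p.Prime) (hr : r.Prime) (hψ : orderOf ψ = p) (hrp : r ≠ p) (hχ : ¬ r ∣ orderOf χ) :
    ¬ r ∣ orderOf (χ * ψ ^ j) := by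
  intro h
  have h1 := h.trans ((Commute.all χ (ψ ^ j)).orderOf_mul_dvd_lcm)
  rcases hr.dvd_lcm.1 h1 with h2 | h2
  · exact hχ h2
  · exact hrp ((Nat.prime_dvd_prime_iff_eq hr hp).1 (h2.trans ((orderOf_pow_dvd j).trans hψ.dvd)))

variable {R : ℝ}

open Classical in
/-- Character sums over the free part: the estimate that the core of the sieve rests on. -/
theorem norm_sum_freePart_sub_le (hA : (0 : L) ∉ A)
    (hR : ∀ χ : MulChar L ℂ, χ ≠ 1 → ‖∑ x ∈ A, χ x‖ ≤ R) (P : Finset ℕ)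
    (hP : ∀ p ∈ P, p.Prime ∧ orderOf (ψ p) = p) :
    ∀ χ : MulChar L ℂ, (∀ p ∈ P, ¬ p ∣ orderOf χ) →
      ‖∑ x ∈ freePart A ψ P, χ x - (if χ = 1 then (∏ p ∈ P, (1 - (p : ℂ)⁻¹)) * A.card else 0)‖
        ≤ (∏ p ∈ P, (1 - (p : ℝ)⁻¹)) * (2 ^ P.card - if χ = 1 then 1 else 0) * R := by
  induction P using Finset.induction_on with
  | empty =>
    intro χ _
    rw [freePart_empty]
    split_ifs with h
    · subst h
      have : ∑ x ∈ A, (1 : MulChar L ℂ) x = A.card := by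
        rw [Finset.sum_congr rfl fun x hx =>
          MulChar.one_apply (R' := ℂ) (ne_of_mem_of_not_mem hx hA).isUnit]
        simp
      simp [this]
    · simpa using hR χ h
  | insert p P hpP ih =>
    intro χ hχ
    have ih := ih fun r hr => hP r (Finset.mem_insert_of_mem hr)
    obtain ⟨hp, hψ⟩ := hP p (Finset.mem_insert_self _ _)
    have hpχ := hχ p (Finset.mem_insert_self _ _)
    set θ : ℝ := ∏ p ∈ P, (1 - (p : ℝ)⁻¹) with hθ
    set M : MulChar L ℂ → ℂ := fun χ =>
      if χ = 1 then (∏ p ∈ P, (1 - (p : ℂ)⁻¹)) * A.card else 0 with hM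
    -- Since `p` does not divide the order of `χ`, each twist by `ψ p ^ j` with `0 < j < p` is
    -- nontrivial and has no main term.
    have key : ∀ j ∈ (Finset.range p).erase 0,
        ‖∑ x ∈ freePart A ψ P, (χ * ψ p ^ j) x‖ ≤ θ * 2 ^ P.card * R := by
      intro j hj
      rw [Finset.mem_erase, Finset.mem_range] at hj
      have hne := mul_pow_ne_one_of_not_dvd_orderOf hp hψ hpχ (Nat.pos_of_ne_zero hj.1) hj.2
      have := ih (χ * ψ p ^ j) fun r hr => not_dvd_orderOf_mul_pow hp
        (hP r (Finset.mem_insert_of_mem hr)).1 hψ (ne_of_mem_of_not_mem hr hpP)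
        (hχ r (Finset.mem_insert_of_mem hr))
      simpa [hne] using this
    have h0 := ih χ fun r hr => hχ r (Finset.mem_insert_of_mem hr)
    -- Removing the elements with `ψ p x = 1` and splitting off `j = 0` from the average leaves the
    -- factor `1 - 1 / p`.
    have hsum : ∑ x ∈ freePart A ψ (insert p P), χ x
        = (1 - (p : ℂ)⁻¹) * ∑ x ∈ freePart A ψ P, χ x
          - (p : ℂ)⁻¹ * ∑ j ∈ (Finset.range p).erase 0,
            ∑ x ∈ freePart A ψ P, (χ * ψ p ^ j) x := by
      have h1 := Finset.sum_filter_add_sum_filter_not (freePart A ψ P) (fun x => ψ p x = 1) χ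
      have h2 := sum_freePart_filter_eq_one (ψ := ψ) hA P hp hψ χ
      rw [← Finset.add_sum_erase _ _ (Finset.mem_range.2 hp.pos)] at h2
      simp only [pow_zero, mul_one] at h2
      rw [freePart_insert]
      linear_combination h1 - h2
    have hp1 : (0 : ℝ) < p := by exact_mod_cast hp.pos
    have hp2 : (0 : ℝ) ≤ 1 - (p : ℝ)⁻¹ := by
      rw [sub_nonneg]
      exact inv_le_one_of_one_le₀ (by exact_mod_cast hp.one_lt.le)
    have hM' : (if χ = 1 then (∏ p ∈ insert p P, (1 - (p : ℂ)⁻¹)) * A.card else 0)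
        = (1 - (p : ℂ)⁻¹) * M χ := by
      simp only [hM]
      split_ifs
      · rw [Finset.prod_insert hpP, mul_assoc]
      · rw [mul_zero]
    rw [hM', hsum]
    calc _ = ‖(1 - (p : ℂ)⁻¹) * (∑ x ∈ freePart A ψ P, χ x - M χ)
          - (p : ℂ)⁻¹ * ∑ j ∈ (Finset.range p).erase 0,
            ∑ x ∈ freePart A ψ P, (χ * ψ p ^ j) x‖ := by congr 1; ring
      _ ≤ (1 - (p : ℝ)⁻¹) * (θ * (2 ^ P.card - if χ = 1 then 1 else 0) * R)
          + (p : ℝ)⁻¹ * ((p - 1) * (θ * 2 ^ P.card * R)) := by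
        refine (norm_sub_le _ _).trans (add_le_add ?_ ?_)
        · rw [norm_mul]
          have : ‖1 - (p : ℂ)⁻¹‖ = 1 - (p : ℝ)⁻¹ := by
            rw [show (1 - (p : ℂ)⁻¹) = ((1 - (p : ℝ)⁻¹ : ℝ) : ℂ) by push_cast; rfl,
              Complex.norm_real, Real.norm_of_nonneg hp2]
          rw [this]
          exact mul_le_mul_of_nonneg_left h0 hp2
        · rw [norm_mul, norm_inv, Complex.norm_natCast]
          refine mul_le_mul_of_nonneg_left ?_ (by positivity)
          refine (norm_sum_le_of_le _ key).trans (le_of_eq ?_)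
          rw [Finset.sum_const, nsmul_eq_mul, Finset.card_erase_of_mem (Finset.mem_range.2 hp.pos),
            Finset.card_range, Nat.cast_sub hp.pos, Nat.cast_one]
      _ = _ := by
        rw [Finset.prod_insert hpP, Finset.card_insert_of_notMem hpP, ← hθ, pow_succ]
        field_simp
        ring

theorem abs_card_freePart_sub_le (hA : (0 : L) ∉ A)
    (hR : ∀ χ : MulChar L ℂ, χ ≠ 1 → ‖∑ x ∈ A, χ x‖ ≤ R) (P : Finset ℕ)
    (hP : ∀ p ∈ P, p.Prime ∧ orderOf (ψ p) = p) :
    |((freePart A ψ P).card : ℝ) - (∏ p ∈ P, (1 - (p : ℝ)⁻¹)) * A.card|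
      ≤ (∏ p ∈ P, (1 - (p : ℝ)⁻¹)) * (2 ^ P.card - 1) * R := by
  have h := norm_sum_freePart_sub_le hA hR P hP 1 fun p hp => by
    rw [orderOf_one]
    exact (hP p hp).1.not_dvd_one
  have h1 : ∑ x ∈ freePart A ψ P, (1 : MulChar L ℂ) x = ((freePart A ψ P).card : ℂ) := by
    rw [Finset.sum_congr rfl fun x hx => MulChar.one_apply (R' := ℂ)
      (ne_of_mem_of_not_mem (freePart_subset P hx) hA).isUnit]
    simp
  rw [h1, if_pos rfl, if_pos rfl] at h
  rw [← Real.norm_eq_abs, ← Complex.norm_real]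
  push_cast
  exact h

open Classical in
/-- The number of elements of the free part on which a further character takes the value `1`. -/
theorem card_freePart_filter_eq_one_le (hA : (0 : L) ∉ A)
    (hR : ∀ χ : MulChar L ℂ, χ ≠ 1 → ‖∑ x ∈ A, χ x‖ ≤ R) (P : Finset ℕ)
    (hP : ∀ p ∈ P, p.Prime ∧ orderOf (ψ p) = p) {p : ℕ} (hp : p.Prime) (hψ : orderOf (ψ p) = p)
    (hpP : p ∉ P) :
    (((freePart A ψ P).filter fun x => ψ p x = 1).card : ℝ)
      ≤ (p : ℝ)⁻¹ * (freePart A ψ P).card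
        + (1 - (p : ℝ)⁻¹) * ((∏ p ∈ P, (1 - (p : ℝ)⁻¹)) * 2 ^ P.card * R) := by
  have hcard : ∀ B ⊆ A, ∑ x ∈ B, (1 : MulChar L ℂ) x = (B.card : ℂ) := by
    intro B hB
    rw [Finset.sum_congr rfl fun x hx => MulChar.one_apply (R' := ℂ)
      (ne_of_mem_of_not_mem (hB hx) hA).isUnit]
    simp
  have h2 := sum_freePart_filter_eq_one (ψ := ψ) hA P hp hψ 1
  rw [← Finset.add_sum_erase _ _ (Finset.mem_range.2 hp.pos), pow_zero, mul_one,
    hcard _ (freePart_subset P), hcard _ ((Finset.filter_subset _ _).trans (freePart_subset P))] at h2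
  have key : ∀ j ∈ (Finset.range p).erase 0,
      ‖∑ x ∈ freePart A ψ P, (1 * ψ p ^ j) x‖ ≤ (∏ p ∈ P, (1 - (p : ℝ)⁻¹)) * 2 ^ P.card * R := by
    intro j hj
    rw [Finset.mem_erase, Finset.mem_range] at hj
    have hne : 1 * ψ p ^ j ≠ 1 := mul_pow_ne_one_of_not_dvd_orderOf hp hψ
      (by rw [orderOf_one]; exact hp.not_dvd_one) (Nat.pos_of_ne_zero hj.1) hj.2
    have := norm_sum_freePart_sub_le hA hR P hP (1 * ψ p ^ j) fun r hr =>
      not_dvd_orderOf_mul_pow hp (hP r hr).1 hψ (ne_of_mem_of_not_mem hr hpP)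
        (by rw [orderOf_one]; exact (hP r hr).1.not_dvd_one)
    rw [if_neg hne, if_neg hne] at this
    simpa only [sub_zero] using this
  have hp1 : (0 : ℝ) < p := by exact_mod_cast hp.pos
  rw [← Complex.norm_natCast, h2, norm_mul, norm_inv, Complex.norm_natCast]
  calc _ ≤ (p : ℝ)⁻¹ * ((freePart A ψ P).card
        + (p - 1) * ((∏ p ∈ P, (1 - (p : ℝ)⁻¹)) * 2 ^ P.card * R)) := by
        refine mul_le_mul_of_nonneg_left ((norm_add_le _ _).trans (add_le_add ?_ ?_))
          (by positivity)
        · rw [Complex.norm_natCast]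
        · refine (norm_sum_le_of_le _ key).trans (le_of_eq ?_)
          rw [Finset.sum_const, nsmul_eq_mul, Finset.card_erase_of_mem (Finset.mem_range.2 hp.pos),
            Finset.card_range, Nat.cast_sub hp.pos, Nat.cast_one]
    _ = _ := by
      field_simp

/-- The prime sieve of Cohen and Huczynska with core `P` and sieving primes `S`. -/
theorem exists_mem_freePart_of_sieve (hA : (0 : L) ∉ A) (hR : ∀ χ : MulChar L ℂ, χ ≠ 1 → ‖∑ x ∈ A, χ x‖ ≤ R) (P S : Finset ℕ) (hPS : Disjoint P S)
    (hP : ∀ p ∈ P, p.Prime ∧ orderOf (ψ p) = p) (hS : ∀ p ∈ S, p.Prime ∧ orderOf (ψ p) = p)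
    {δ : ℝ} (hδ0 : 0 < δ) (hδ : δ = 1 - ∑ p ∈ S, (p : ℝ)⁻¹)
    (h : ((S.card : ℝ) - 1 + δ) * 2 ^ P.card * R + δ * (2 ^ P.card - 1) * R < δ * A.card) :
    ∃ x ∈ A, ∀ p ∈ P ∪ S, ψ p x ≠ 1 := by
  classical
  by_contra! hno
  have hθ : 0 < ∏ p ∈ P, (1 - (p : ℝ)⁻¹) := by
    refine Finset.prod_pos fun p hp => ?_
    rw [sub_pos]
    exact inv_lt_one_of_one_lt₀ (by exact_mod_cast (hP p hp).1.one_lt)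
  set θ := ∏ p ∈ P, (1 - (p : ℝ)⁻¹)
  -- If no element survives, each element of the core-free part is removed by some sieving prime,
  -- and the union bound contradicts `h`.
  have hcov : freePart A ψ P ⊆ S.biUnion fun p => (freePart A ψ P).filter fun x => ψ p x = 1 := by
    intro x hx
    obtain ⟨p, hp, hpx⟩ := hno x (freePart_subset P hx)
    rw [Finset.mem_biUnion]
    rcases Finset.mem_union.1 hp with hp | hp
    · exact absurd hpx ((Finset.mem_filter.1 hx).2 p hp)
    · exact ⟨p, hp, Finset.mem_filter.2 ⟨hx, hpx⟩⟩
  have h1 : ((freePart A ψ P).card : ℝ)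
      ≤ ∑ p ∈ S, (((freePart A ψ P).filter fun x => ψ p x = 1).card : ℝ) := by
    exact_mod_cast (Finset.card_le_card hcov).trans Finset.card_biUnion_le
  have h2 := h1.trans (Finset.sum_le_sum fun p hp => card_freePart_filter_eq_one_le hA hR P hP
    (hS p hp).1 (hS p hp).2 (Finset.disjoint_right.1 hPS hp))
  rw [Finset.sum_add_distrib, ← Finset.sum_mul, ← Finset.sum_mul, Finset.sum_sub_distrib,
    Finset.sum_const, nsmul_eq_mul, mul_one] at h2
  have h3 := (abs_le.1 (abs_card_freePart_sub_le hA hR P hP)).1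
  have h4 : δ * (freePart A ψ P).card ≤ (S.card - 1 + δ) * (θ * 2 ^ P.card * R) := by
    rw [hδ]
    linarith
  have h5 : θ * A.card - θ * (2 ^ P.card - 1) * R ≤ (freePart A ψ P).card := by linarith
  have h6 : θ * (δ * (A.card - (2 ^ P.card - 1) * R))
      ≤ θ * ((S.card - 1 + δ) * (2 ^ P.card * R)) := by
    have := mul_le_mul_of_nonneg_left h5 (hδ0.le)
    linarith
  have h7 := le_of_mul_le_mul_left h6 hθ
  linarith

end sieve

/-! ### From characters to primitive elements -/

/-- The multiplicative group is cyclic, so the hypothesis makes `x` a `p`-th power, and `ψ ^ p` is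
trivial. -/
theorem MulChar.apply_eq_one_of_pow_eq_one {L : Type*} [Field L] [Fintype L] {ψ : MulChar L ℂ}
    {p : ℕ} (hp : p ∈ (Fintype.card L - 1).primeFactors) (hψ : orderOf ψ = p) {x : L} (hx : x ≠ 0)
    (h : x ^ ((Fintype.card L - 1) / p) = 1) : ψ x = 1 := by
  classical
  have hcard : Fintype.card Lˣ = Fintype.card L - 1 := Fintype.card_units L
  have hp' := Nat.prime_of_mem_primeFactors hp
  obtain ⟨g, hg⟩ := IsCyclic.exists_generator (α := Lˣ)
  have hgo : orderOf g = Fintype.card L - 1 :=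
    (orderOf_eq_card_of_forall_mem_zpowers hg).trans (Nat.card_eq_fintype_card.trans hcard)
  obtain ⟨i, hi⟩ := mem_powers_iff_mem_zpowers.2 (hg (Units.mk0 x hx))
  simp only at hi
  obtain ⟨m, hm⟩ := Nat.dvd_of_mem_primeFactors hp
  have hm0 : 0 < m := Nat.pos_of_ne_zero fun h0 => by
    have := Fintype.one_lt_card (α := L)
    rw [h0] at hm
    omega
  rw [hm, Nat.mul_div_cancel_left _ hp'.pos] at h
  have h1 : g ^ (i * m) = 1 := by
    rw [pow_mul, hi]
    exact Units.ext (by simpa using h)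
  have h2 := orderOf_dvd_of_pow_eq_one h1
  rw [hgo, hm] at h2
  obtain ⟨t, rfl⟩ := Nat.dvd_of_mul_dvd_mul_right hm0 h2
  have hxu : x = ((g ^ t : Lˣ) : L) ^ p := by
    rw [← Units.val_pow_eq_pow_val, ← pow_mul, mul_comm t p, hi, Units.val_mk0]
  have h3 : ψ ^ p = 1 := hψ ▸ pow_orderOf_eq_one ψ
  rw [hxu, map_pow, ← MulChar.pow_apply' _ hp'.ne_zero, h3]
  exact MulChar.one_apply (Units.isUnit _)

theorem isPrimitiveElement_of_forall_pow_ne_one {L : Type*} [Field L] [Fintype L] {x : L}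
    (hx : x ≠ 0)
    (h : ∀ p ∈ (Fintype.card L - 1).primeFactors, x ^ ((Fintype.card L - 1) / p) ≠ 1) :
    IsPrimitiveElement x := by
  classical
  have hcard : Fintype.card Lˣ = Fintype.card L - 1 := Fintype.card_units L
  refine ⟨Units.mk0 x hx, rfl, fun v => ?_⟩
  have hord : orderOf (Units.mk0 x hx) = Fintype.card L - 1 := by
    refine orderOf_eq_of_pow_and_pow_div_prime (hcard ▸ Fintype.card_pos)
      (hcard ▸ pow_card_eq_one) fun p hp hpd h1 => ?_
    refine h p (Nat.mem_primeFactors.2 ⟨hp, hpd, (hcard ▸ Fintype.card_pos).ne'⟩) ?_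
    simpa using congrArg (Units.val) h1
  have : Subgroup.zpowers (Units.mk0 x hx) = ⊤ := by
    apply Subgroup.eq_top_of_card_eq
    rw [Nat.card_zpowers, hord, Nat.card_eq_fintype_card, hcard]
  rw [this]
  trivial

theorem exists_mulChar_family (L : Type*) [Field L] [Fintype L] :
    ∃ ψ : ℕ → MulChar L ℂ, ∀ p ∈ (Fintype.card L - 1).primeFactors, orderOf (ψ p) = p := by
  have : ∀ p, ∃ ψ : MulChar L ℂ, p ∈ (Fintype.card L - 1).primeFactors → orderOf ψ = p := by
    intro p
    by_cases hp : p ∈ (Fintype.card L - 1).primeFactors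
    · obtain ⟨ψ, hψ⟩ := MulChar.exists_mulChar_orderOf L (R := ℂ) (Nat.dvd_of_mem_primeFactors hp)
        (Complex.isPrimitiveRoot_exp p (Nat.prime_of_mem_primeFactors hp).ne_zero)
      exact ⟨ψ, fun _ => hψ⟩
    · exact ⟨1, fun h => absurd h hp⟩
  choose ψ hψ using this
  exact ⟨ψ, hψ⟩

/-- A sufficient numerical condition for a primitive element with a prescribed nonzero value of a
linear functional: `M` is the number of elements on which the functional takes that value. -/
theorem exists_isPrimitiveElement_of_sieve {E L : Type*} [Field E] [Field L] [Algebra E L]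
    [Fintype E] [Fintype L] (T : L →ₗ[E] E) (hT : Function.Surjective T) {b : E} (hb : b ≠ 0)
    {R : ℝ} (hR0 : 0 ≤ R) (hR : R ^ 2 * Fintype.card E = Fintype.card L)
    (S : Finset ℕ) (hS : S ⊆ (Fintype.card L - 1).primeFactors)
    (hδ0 : 0 < 1 - ∑ p ∈ S, (p : ℝ)⁻¹)
    (h : ((S.card : ℝ) - 1 + (1 - ∑ p ∈ S, (p : ℝ)⁻¹))
          * 2 ^ ((Fintype.card L - 1).primeFactors \ S).card
        + (1 - ∑ p ∈ S, (p : ℝ)⁻¹) * (2 ^ ((Fintype.card L - 1).primeFactors \ S).card - 1)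
        < (1 - ∑ p ∈ S, (p : ℝ)⁻¹) * R) :
    ∃ α : L, IsPrimitiveElement α ∧ T α = b := by
  classical
  obtain ⟨ψ, hψ⟩ := exists_mulChar_family L
  set A : Finset L := Finset.univ.filter fun x => T x = b with hAdef
  have hA : (0 : L) ∉ A := by simp [hAdef, hb.symm]
  have hcardA : (A.card : ℝ) = R ^ 2 := by
    have h1 := card_fiber_mul_card T hT b
    have h2 : (A.card : ℝ) * Fintype.card E = R ^ 2 * Fintype.card E := by
      rw [hR]
      exact_mod_cast h1
    exact mul_right_cancel₀ (by exact_mod_cast Fintype.card_ne_zero) h2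
  have hchar : ∀ χ : MulChar L ℂ, χ ≠ 1 → ‖∑ x ∈ A, χ x‖ ≤ R := by
    intro χ hχ
    have h1 := norm_fiber_sum_sq_le T hT hχ hb
    rw [← hAdef, hcardA] at h1
    exact (pow_le_pow_iff_left₀ (norm_nonneg _) hR0 two_ne_zero).1 h1
  have hRpos : 0 < R := by
    rcases hR0.eq_or_lt with rfl | h0
    · have : (Fintype.card L : ℝ) ≠ 0 := by exact_mod_cast Fintype.card_ne_zero
      exact absurd (by simpa using hR.symm) this
    · exact h0
  have hpr : ∀ p ∈ (Fintype.card L - 1).primeFactors, p.Prime ∧ orderOf (ψ p) = p :=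
    fun p hp => ⟨Nat.prime_of_mem_primeFactors hp, hψ p hp⟩
  obtain ⟨x, hxA, hx⟩ := exists_mem_freePart_of_sieve hA hchar
    ((Fintype.card L - 1).primeFactors \ S) S Finset.sdiff_disjoint
    (fun p hp => hpr p (Finset.mem_sdiff.1 hp).1) (fun p hp => hpr p (hS hp)) hδ0 rfl (by
      -- The fibre has `R ^ 2` elements, so the sieve inequality is `h` multiplied by `R`.
      rw [hcardA]
      nlinarith [mul_lt_mul_of_pos_right h hRpos])
  rw [Finset.sdiff_union_of_subset hS] at hx
  have hx0 : x ≠ 0 := fun h0 => hA (h0 ▸ hxA)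
  exact ⟨x, isPrimitiveElement_of_forall_pow_ne_one hx0 fun p hp h1 =>
    hx p hp (MulChar.apply_eq_one_of_pow_eq_one hp (hψ p hp) hx0 h1),
    (Finset.mem_filter.1 hxA).2⟩

/-! ### The exceptional extension of 64 by 4096 elements -/

theorem mem_range_algebraMap_of_pow_card_eq {E L : Type*} [Field E] [Field L] [Algebra E L]
    [Fintype E] [Finite L] {x : L} (h : x ^ Fintype.card E = x) : x ∈ Set.range (algebraMap E L) := by
  rw [IsGalois.mem_range_algebraMap_iff_fixed]
  intro σ
  obtain ⟨i, rfl⟩ := (FiniteField.bijective_frobeniusAlgEquivOfAlgebraic_pow E L).2 σ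
  rw [AlgEquiv.coe_pow]
  exact Function.iterate_fixed h _

/-- On a fibre over `b ≠ 0` the map `x ↦ x ^ (|E| - 1)` is injective: equal values put `x / y` in
`E`, and linearity of `T` makes that ratio 1. The images are `e`-th roots of unity. -/
theorem card_fiber_filter_pow_eq_one_le {E L : Type*} [Field E] [Field L] [Algebra E L]
    [Fintype E] [Fintype L] [DecidableEq E] [DecidableEq L] (T : L →ₗ[E] E) {b : E} (hb : b ≠ 0)
    {e : ℕ} (he : 0 < e) :
    ((Finset.univ.filter fun x => T x = b).filter
      fun x => x ^ ((Fintype.card E - 1) * e) = 1).card ≤ e := by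
  have hinj : Set.InjOn (fun x : L => x ^ (Fintype.card E - 1))
      ((Finset.univ.filter fun x => T x = b).filter
        fun x => x ^ ((Fintype.card E - 1) * e) = 1 : Finset L) := by
    intro x hx y hy hxy
    simp only [Finset.coe_filter, Finset.mem_filter, Finset.mem_univ, true_and,
      Set.mem_ofPred_eq] at hx hy hxy
    have hy0 : y ≠ 0 := by
      rintro rfl
      exact hb (by rw [← hy.1, map_zero])
    have h1 : (x / y) ^ Fintype.card E = x / y := by
      obtain ⟨c, hc⟩ := Nat.exists_eq_add_of_le' (Fintype.card_pos (α := E))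
      rw [hc, Nat.add_sub_cancel] at hxy
      rw [hc, pow_succ, div_pow, hxy, div_self (pow_ne_zero _ hy0), one_mul]
    have h2 : x / y ∈ Set.range (algebraMap E L) :=
      mem_range_algebraMap_of_pow_card_eq h1
    obtain ⟨c, hc⟩ := h2
    have hxc : x = c • y := by rw [Algebra.smul_def, hc, div_mul_cancel₀ _ hy0]
    have h3 : c * b = b := by
      rw [← hy.1, ← smul_eq_mul, ← map_smul, ← hxc, hx.1, hy.1]
    rw [hxc, (mul_eq_right₀ hb).1 h3, one_smul]
  rw [← Finset.card_image_of_injOn hinj]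
  refine (Finset.card_le_card (t := (Polynomial.nthRoots e (1 : L)).toFinset) ?_).trans
    ((Multiset.toFinset_card_le _).trans (Polynomial.card_nthRoots e 1))
  intro z hz
  obtain ⟨x, hx, rfl⟩ := Finset.mem_image.1 hz
  rw [Multiset.mem_toFinset, Polynomial.mem_nthRoots he, ← pow_mul]
  exact (Finset.mem_filter.1 hx).2

/-- The sieve inequality fails here for every choice of sieving primes. The primes dividing 4095 are
3, 5, 7, 13. Character sums show that 3 and 7 exclude at most 26 and 16 elements. As `4095 / 5 = 63
* 13` and `4095 / 13 = 63 * 5`, counting roots of unity bounds the exclusions for 5 and 13 by 13 and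
5. The total 60 is below the fibre size 64. -/
theorem exists_isPrimitiveElement_of_card_eq_64 {E L : Type*} [Field E] [Field L] [Algebra E L]
    [Fintype E] [Fintype L] (T : L →ₗ[E] E) (hT : Function.Surjective T) {b : E} (hb : b ≠ 0)
    (hE : Fintype.card E = 64) (hL : Fintype.card L = 4096) :
    ∃ α : L, IsPrimitiveElement α ∧ T α = b := by
  classical
  obtain ⟨ψ, hψ⟩ := exists_mulChar_family L
  have hpf : (Fintype.card L - 1).primeFactors = {3, 5, 7, 13} := by
    rw [hL]
    norm_num
    decide +kernel
  set A : Finset L := Finset.univ.filter fun x => T x = b with hAdef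
  have hA : (0 : L) ∉ A := by simp [hAdef, hb.symm]
  have hcardA : A.card = 64 := by
    have h1 := card_fiber_mul_card T hT b
    rw [← hAdef, hE, hL] at h1
    omega
  have hchar : ∀ χ : MulChar L ℂ, χ ≠ 1 → ‖∑ x ∈ A, χ x‖ ≤ 8 := by
    intro χ hχ
    have h1 := norm_fiber_sum_sq_le T hT hχ hb
    rw [← hAdef, hcardA] at h1
    refine (pow_le_pow_iff_left₀ (norm_nonneg _) (by norm_num) two_ne_zero).1 (h1.trans ?_)
    norm_num
  by_contra! hno
  have hcov : A ⊆ (Fintype.card L - 1).primeFactors.biUnion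
      fun p => A.filter fun x => x ^ ((Fintype.card L - 1) / p) = 1 := by
    intro x hx
    by_contra hx'
    refine hno x (isPrimitiveElement_of_forall_pow_ne_one (fun h0 => hA (h0 ▸ hx))
      fun p hp h1 => hx' ?_) (Finset.mem_filter.1 hx).2
    exact Finset.mem_biUnion.2 ⟨p, hp, Finset.mem_filter.2 ⟨hx, h1⟩⟩
  have hle := (Finset.card_le_card hcov).trans Finset.card_biUnion_le
  have hbound : ∀ p ∈ (Fintype.card L - 1).primeFactors,
      ((A.filter fun x => x ^ ((Fintype.card L - 1) / p) = 1).card : ℝ)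
        ≤ (p : ℝ)⁻¹ * 64 + (1 - (p : ℝ)⁻¹) * 8 := by
    intro p hp
    have h1 := card_freePart_filter_eq_one_le (ψ := ψ) hA hchar ∅ (by simp)
      (Nat.prime_of_mem_primeFactors hp) (hψ p hp) (by simp)
    rw [freePart_empty, hcardA] at h1
    simp only [Finset.prod_empty, Finset.card_empty, pow_zero, one_mul] at h1
    refine le_trans ?_ (by exact_mod_cast h1)
    exact_mod_cast Finset.card_le_card fun x hx => Finset.mem_filter.2
      ⟨(Finset.mem_filter.1 hx).1, MulChar.apply_eq_one_of_pow_eq_one hp (hψ p hp)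
        (fun h0 => hA (h0 ▸ (Finset.mem_filter.1 hx).1)) (Finset.mem_filter.1 hx).2⟩
  have h3 := hbound 3 (by rw [hpf]; decide)
  have h7 := hbound 7 (by rw [hpf]; decide)
  have h5 := card_fiber_filter_pow_eq_one_le T hb (e := 13) (by norm_num)
  have h13 := card_fiber_filter_pow_eq_one_le T hb (e := 5) (by norm_num)
  rw [hpf, hcardA] at hle
  rw [hE] at h5 h13
  rw [hL] at hle h3 h7
  simp only [← hAdef] at h5 h13
  norm_num at hle h3 h7 h5 h13
  have h3' : (A.filter fun x => x ^ 1365 = 1).card ≤ 26 := by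
    by_contra! hlt
    have : (27 : ℝ) ≤ (A.filter fun x => x ^ 1365 = 1).card := by exact_mod_cast hlt
    linarith
  have h7' : (A.filter fun x => x ^ 585 = 1).card ≤ 16 := by
    by_contra! hlt
    have : (17 : ℝ) ≤ (A.filter fun x => x ^ 585 = 1).card := by exact_mod_cast hlt
    linarith
  omega

/-! ### Numerical verification of the sieve condition -/

/-- The primes from `11` to `61`. -/
def midPrimes : Finset ℕ := {11, 13, 17, 19, 23, 29, 31, 37, 41, 43, 47, 53, 59, 61}

theorem mem_midPrimes {p : ℕ} (hp : p.Prime) (h8 : 8 ≤ p) (h64 : p < 64) : p ∈ midPrimes := by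
  unfold midPrimes
  interval_cases p <;> first | decide | (exfalso; revert hp; norm_num)

/-- Only primes below 64 have `1 / p - 1 / 64` positive, and over all of `midPrimes` these excesses
add up to at most 0.319. -/
theorem sum_inv_le_of_primes {S : Finset ℕ} (hS : ∀ p ∈ S, p.Prime ∧ 8 ≤ p) :
    ∑ p ∈ S, (p : ℝ)⁻¹ ≤ S.card / 64 + 319 / 1000 := by
  have h1 : ∑ p ∈ S, ((p : ℝ)⁻¹ - 1 / 64) ≤ ∑ p ∈ midPrimes, ((p : ℝ)⁻¹ - 1 / 64) := by
    rw [← Finset.sum_filter_add_sum_filter_not S (· < 64)]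
    have h2 : ∑ p ∈ S with ¬ p < 64, ((p : ℝ)⁻¹ - 1 / 64) ≤ 0 := by
      refine Finset.sum_nonpos fun p hp => ?_
      have : (64 : ℝ) ≤ p := by exact_mod_cast not_lt.1 (Finset.mem_filter.1 hp).2
      rw [sub_nonpos, inv_eq_one_div]
      exact one_div_le_one_div_of_le (by norm_num) this
    have h3 : ∑ p ∈ S with p < 64, ((p : ℝ)⁻¹ - 1 / 64)
        ≤ ∑ p ∈ midPrimes, ((p : ℝ)⁻¹ - 1 / 64) := by
      refine Finset.sum_le_sum_of_subset_of_nonneg ?_ ?_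
      · intro p hp
        obtain ⟨hpS, hp64⟩ := Finset.mem_filter.1 hp
        exact mem_midPrimes (hS p hpS).1 (hS p hpS).2 hp64
      · intro p hp _
        have : (0 : ℝ) < p ∧ (p : ℝ) ≤ 64 := by
          simp only [midPrimes, Finset.mem_insert, Finset.mem_singleton] at hp
          rcases hp with rfl | rfl | rfl | rfl | rfl | rfl | rfl | rfl | rfl | rfl | rfl | rfl |
            rfl | rfl <;> norm_num
        rw [sub_nonneg, inv_eq_one_div]
        exact one_div_le_one_div_of_le this.1 this.2
    linarith
  have h4 : ∑ p ∈ midPrimes, ((p : ℝ)⁻¹ - 1 / 64) ≤ 319 / 1000 := by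
    simp only [midPrimes]
    norm_num
  rw [Finset.sum_sub_distrib, Finset.sum_const, nsmul_eq_mul] at h1
  linarith

/-- The same comparison multiplicatively: `64 / p` exceeds 1 only for primes below 64. This bounds
the number of primes through the size of their product. -/
theorem pow_card_le_of_primes {S : Finset ℕ} (hS : ∀ p ∈ S, p.Prime ∧ 8 ≤ p) :
    64 ^ S.card ≤ 2 ^ 16 * ∏ p ∈ S, p := by
  have h1 : (∏ p ∈ S, (64 / p : ℝ)) ≤ ∏ p ∈ midPrimes, (64 / p : ℝ) := by
    rw [← Finset.prod_filter_mul_prod_filter_not S (· < 64)]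
    have h2 : ∏ p ∈ S with ¬ p < 64, (64 / p : ℝ) ≤ 1 := by
      refine Finset.prod_le_one (fun p _ => by positivity) fun p hp => ?_
      have : (64 : ℝ) ≤ p := by exact_mod_cast not_lt.1 (Finset.mem_filter.1 hp).2
      exact div_le_one_of_le₀ this (by positivity)
    have h3 : ∏ p ∈ S with p < 64, (64 / p : ℝ) ≤ ∏ p ∈ midPrimes, (64 / p : ℝ) := by
      refine Finset.prod_le_prod_of_subset_of_one_le ?_ ?_ ?_
      · intro p hp
        obtain ⟨hpS, hp64⟩ := Finset.mem_filter.1 hp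
        exact mem_midPrimes (hS p hpS).1 (hS p hpS).2 hp64
      · intro p _
        positivity
      · intro p hp _
        have : (0 : ℝ) < p ∧ (p : ℝ) ≤ 64 := by
          simp only [midPrimes, Finset.mem_insert, Finset.mem_singleton] at hp
          rcases hp with rfl | rfl | rfl | rfl | rfl | rfl | rfl | rfl | rfl | rfl | rfl | rfl |
            rfl | rfl <;> norm_num
        rw [one_le_div this.1]
        exact this.2
    calc _ ≤ (∏ p ∈ S with p < 64, (64 / p : ℝ)) * 1 :=
          mul_le_mul_of_nonneg_left h2 (Finset.prod_nonneg fun p _ => by positivity)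
      _ ≤ _ := by rw [mul_one]; exact h3
  have h4 : ∏ p ∈ midPrimes, (64 / p : ℝ) ≤ 2 ^ 16 := by
    simp only [midPrimes]
    norm_num
  rw [Finset.prod_div_distrib, Finset.prod_const] at h1
  have h5 : (0 : ℝ) < ∏ p ∈ S, (p : ℝ) :=
    Finset.prod_pos fun p hp => by exact_mod_cast (hS p hp).1.pos
  have h6 := (div_le_iff₀ h5).1 (h1.trans h4)
  have h7 : ((64 ^ S.card : ℕ) : ℝ) ≤ ((2 ^ 16 * ∏ p ∈ S, p : ℕ) : ℝ) := by
    push_cast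
    norm_num at h6 ⊢
    exact h6
  exact Nat.cast_le.1 h7

/-- The core consists of primes among 2, 3, 5, 7, and all larger primes are sieved. With 16 or more
larger primes, `R` is so large that no sieving is needed. -/
theorem sieve_condition_of_large {N : ℕ} {R : ℝ} (hN0 : N ≠ 0) (hR : 234 ≤ R)
    (hN : (N : ℝ) ≤ R ^ 4) :
    ∃ S ⊆ N.primeFactors, 0 < 1 - ∑ p ∈ S, (p : ℝ)⁻¹ ∧
      ((S.card : ℝ) - 1 + (1 - ∑ p ∈ S, (p : ℝ)⁻¹)) * 2 ^ (N.primeFactors \ S).card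
        + (1 - ∑ p ∈ S, (p : ℝ)⁻¹) * (2 ^ (N.primeFactors \ S).card - 1)
        < (1 - ∑ p ∈ S, (p : ℝ)⁻¹) * R := by
  set S := N.primeFactors.filter fun p => 8 ≤ p with hSdef
  have hS : ∀ p ∈ S, p.Prime ∧ 8 ≤ p := fun p hp =>
    ⟨Nat.prime_of_mem_primeFactors (Finset.mem_filter.1 hp).1, (Finset.mem_filter.1 hp).2⟩
  have hsub : S ⊆ N.primeFactors := Finset.filter_subset _ _
  have hcore : (N.primeFactors \ S).card ≤ 4 := by
    have : N.primeFactors \ S ⊆ {2, 3, 5, 7} := by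
      intro p hp
      rw [Finset.mem_sdiff, hSdef, Finset.mem_filter] at hp
      have hpp := Nat.prime_of_mem_primeFactors hp.1
      have : p < 8 := by
        by_contra! h
        exact hp.2 ⟨hp.1, h⟩
      interval_cases p <;> first | decide | (exfalso; revert hpp; norm_num)
    exact (Finset.card_le_card this).trans (by decide)
  have hprod : (64 : ℝ) ^ S.card ≤ 2 ^ 16 * R ^ 4 := by
    have h1 : ∏ p ∈ S, p ≤ N :=
      (Finset.prod_le_prod_of_subset_of_one_le' hsub fun p hp _ =>
        (Nat.prime_of_mem_primeFactors hp).pos).trans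
        (Nat.le_of_dvd (Nat.pos_of_ne_zero hN0) (Nat.prod_primeFactors_dvd N))
    have h2 := (pow_card_le_of_primes hS).trans (Nat.mul_le_mul_left _ h1)
    have h3 : (64 : ℝ) ^ S.card ≤ 2 ^ 16 * N := by exact_mod_cast h2
    linarith
  by_cases hs : S.card ≤ 15
  · refine ⟨S, hsub, ?_⟩
    have hsum := sum_inv_le_of_primes hS
    have hs' : (S.card : ℝ) ≤ 15 := by exact_mod_cast hs
    set σ := ∑ p ∈ S, (p : ℝ)⁻¹
    have hδ : 681 / 1000 - (S.card : ℝ) / 64 ≤ 1 - σ := by linarith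
    have hδ0 : 0 < 1 - σ := by linarith
    refine ⟨hδ0, ?_⟩
    have hW : (2 : ℝ) ^ (N.primeFactors \ S).card ≤ 16 := by
      calc _ ≤ (2 : ℝ) ^ 4 := pow_le_pow_right₀ (by norm_num) hcore
        _ = 16 := by norm_num
    have hW1 : (1 : ℝ) ≤ 2 ^ (N.primeFactors \ S).card := one_le_pow₀ (by norm_num)
    set W := (2 : ℝ) ^ (N.primeFactors \ S).card
    -- This is the condition at the worst value `W = 16`; it suffices because the coefficient of `W`
    -- is nonnegative by `hge`. With at most 8 sieving primes `1 - σ ≥ 0.556`, and `112 < 0.556 *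
    -- 203` is where 234 is needed.
    have hgoal : (S.card : ℝ) * 16 + 32 * (1 - σ) < 16 + (1 - σ) * (R + 1) := by
      by_cases hs8 : S.card ≤ 8
      · have : (S.card : ℝ) ≤ 8 := by exact_mod_cast hs8
        nlinarith
      · have h9 : (9 : ℝ) ≤ S.card := by exact_mod_cast not_le.1 hs8
        have h64 : (64 : ℝ) ^ 9 ≤ 64 ^ S.card := pow_le_pow_right₀ (by norm_num) (by omega)
        -- From `64 ^ 9 ≤ 2 ^ 16 * R ^ 4` one gets `R ≥ 2 ^ 9.5`, just above 724.
        have hR' : 724 ≤ R := by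
          by_contra! hlt
          have : R ^ 4 ≤ 724 ^ 4 := pow_le_pow_left₀ (by linarith) hlt.le 4
          norm_num at this h64 hprod
          linarith
        nlinarith
    have hge : 0 ≤ (S.card : ℝ) - 1 + (1 - σ) + (1 - σ) := by
      rcases S.eq_empty_or_nonempty with h0 | h0
      · have : σ = 0 := by simp [σ, h0]
        rw [this, h0]
        norm_num
      · have : (1 : ℝ) ≤ S.card := by exact_mod_cast h0.card_pos
        linarith
    nlinarith [mul_le_mul_of_nonneg_left hW hge]
  · refine ⟨∅, Finset.empty_subset _, by norm_num, ?_⟩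
    have hcard : (N.primeFactors \ ∅).card ≤ 4 + S.card := by
      rw [Finset.sdiff_empty, ← Finset.card_sdiff_add_card_eq_card hsub]
      omega
    have hlt : (2 : ℝ) ^ (4 + S.card) ≤ R := by
      have h1 : ((2 : ℝ) ^ (4 + S.card)) ^ 4 ≤ R ^ 4 := by
        -- The exponents satisfy `4 * (4 + s) + 16 ≤ 6 * s` exactly when `s ≥ 16`.
        have h2 : ((2 : ℝ) ^ (4 + S.card)) ^ 4 * 2 ^ 16 ≤ 64 ^ S.card := by
          rw [show (64 : ℝ) = 2 ^ 6 by norm_num, ← pow_mul, ← pow_mul, ← pow_add]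
          exact pow_le_pow_right₀ (by norm_num) (by omega)
        nlinarith
      exact (pow_le_pow_iff_left₀ (by positivity) (by linarith) (by norm_num)).1 h1
    have hW : (2 : ℝ) ^ (N.primeFactors \ ∅).card ≤ 2 ^ (4 + S.card) :=
      pow_le_pow_right₀ (by norm_num) hcard
    simp only [Finset.card_empty, Finset.sum_empty, Nat.cast_zero]
    linarith

/-- Without sieving primes, `δ = 1` and the condition reduces to `W - 1 < R`. -/
theorem sieve_condition_of_card_primeFactors_le {N t : ℕ} {R : ℝ} (hN : N.primeFactors.card ≤ t)
    (hR : 2 ^ t - 1 < R) :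
    ∃ S ⊆ N.primeFactors, 0 < 1 - ∑ p ∈ S, (p : ℝ)⁻¹ ∧
      ((S.card : ℝ) - 1 + (1 - ∑ p ∈ S, (p : ℝ)⁻¹)) * 2 ^ (N.primeFactors \ S).card
        + (1 - ∑ p ∈ S, (p : ℝ)⁻¹) * (2 ^ (N.primeFactors \ S).card - 1)
        < (1 - ∑ p ∈ S, (p : ℝ)⁻¹) * R := by
  refine ⟨∅, Finset.empty_subset _, by norm_num, ?_⟩
  have hW : (2 : ℝ) ^ (N.primeFactors \ ∅).card ≤ 2 ^ t :=
    pow_le_pow_right₀ (by norm_num) (by rwa [Finset.sdiff_empty])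
  simp only [Finset.card_empty, Finset.sum_empty, Nat.cast_zero]
  linarith

/-- The case `3 ^ 12 - 1` with `R = √(3 ^ 6)`. Five prime factors would need `R > 31` without
sieving, so only 2 is kept in the core. -/
theorem sieve_condition_of_eq_531440 {R : ℝ} (hR : R = 27) :
    ∃ S ⊆ (531440 : ℕ).primeFactors, 0 < 1 - ∑ p ∈ S, (p : ℝ)⁻¹ ∧
      ((S.card : ℝ) - 1 + (1 - ∑ p ∈ S, (p : ℝ)⁻¹)) * 2 ^ ((531440 : ℕ).primeFactors \ S).card
        + (1 - ∑ p ∈ S, (p : ℝ)⁻¹) * (2 ^ ((531440 : ℕ).primeFactors \ S).card - 1)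
        < (1 - ∑ p ∈ S, (p : ℝ)⁻¹) * R := by
  have h : (531440 : ℕ).primeFactors = {2, 5, 7, 13, 73} := by decide +kernel
  have h1 : (({2, 5, 7, 13, 73} : Finset ℕ) \ {5, 7, 13, 73}).card = 1 := by decide
  have h2 : ({5, 7, 13, 73} : Finset ℕ).card = 4 := by decide
  refine ⟨{5, 7, 13, 73}, by rw [h]; decide, ?_, ?_⟩
  · norm_num
  · rw [h, h1, h2, hR]
    norm_num

/-- The bound is `234 ^ 2`. Only `q ≥ 2` is assumed, so 6 occurs among the bases. -/
theorem eq_or_eq_of_pow_lt {q D : ℕ} (hq : 2 ≤ q) (hD6 : 6 ≤ D) (hD : ¬ IsPrimePow D)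
    (h : q ^ D < 54756) :
    (D = 6 ∧ q ∈ ({2, 3, 4, 5, 6} : Finset ℕ)) ∨ (q = 2 ∧ D ∈ ({10, 12, 14, 15} : Finset ℕ)) := by
  have hD16 : D < 16 := by
    by_contra! hle
    have h1 : 2 ^ 16 ≤ q ^ D := (Nat.pow_le_pow_right (by norm_num) hle).trans
      (Nat.pow_le_pow_left hq D)
    norm_num at h1
    omega
  have hq7 : q < 7 := by
    by_contra! hle
    have h1 : 7 ^ 6 ≤ q ^ D := (Nat.pow_le_pow_right (by norm_num) hD6).trans
      (Nat.pow_le_pow_left hle D)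
    norm_num at h1
    omega
  have h7 : IsPrimePow 7 := by decide +kernel
  have h8 : IsPrimePow 8 := by decide +kernel
  have h9 : IsPrimePow 9 := by decide +kernel
  have h11 : IsPrimePow 11 := by decide +kernel
  have h13 : IsPrimePow 13 := by decide +kernel
  interval_cases D <;> first | contradiction | (interval_cases q <;> simp at h ⊢)

/-- The special case of Cohen's theorem on primitive elements with prescribed trace that is used
here: a primitive element with a prescribed nonzero value of a linear functional. -/
theorem exists_isPrimitiveElement_of_ne_zero {E L : Type*} [Field E] [Field L] [Algebra E L]
    [Finite E] [Finite L] (T : L →ₗ[E] E) (hT : Function.Surjective T) {b : E} (hb : b ≠ 0)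
    {q D m : ℕ} (hq : 2 ≤ q) (hD6 : 6 ≤ D) (hD : ¬ IsPrimePow D) (hm : 2 ≤ m)
    (hE : Nat.card E = q ^ D) (hL : Nat.card L = (q ^ D) ^ m) :
    ∃ α : L, IsPrimitiveElement α ∧ T α = b := by
  have := Fintype.ofFinite E
  have := Fintype.ofFinite L
  rw [Nat.card_eq_fintype_card] at hE hL
  have h64 : 64 ≤ q ^ D := (Nat.pow_le_pow_right (n := 2) (by norm_num) hD6).trans
    (Nat.pow_le_pow_left hq D)
  obtain ⟨m, rfl⟩ : ∃ k, m = k + 1 := ⟨m - 1, by omega⟩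
  set R : ℝ := √(((q ^ D) ^ m : ℕ) : ℝ) with hRdef
  have hR0 : 0 ≤ R := Real.sqrt_nonneg _
  have hRsq : R ^ 2 = ((q ^ D) ^ m : ℕ) := Real.sq_sqrt (Nat.cast_nonneg _)
  have hR : R ^ 2 * Fintype.card E = Fintype.card L := by
    rw [hRsq, hE, hL, pow_succ]
    push_cast
    rfl
  have hlt : ∀ {c : ℕ}, c ^ 2 < (q ^ D) ^ m → (c : ℝ) < R := by
    intro c hc
    rw [hRdef]
    refine Real.lt_sqrt_of_sq_lt ?_
    exact_mod_cast hc
  have main : (∃ S ⊆ (Fintype.card L - 1).primeFactors, 0 < 1 - ∑ p ∈ S, (p : ℝ)⁻¹ ∧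
      ((S.card : ℝ) - 1 + (1 - ∑ p ∈ S, (p : ℝ)⁻¹))
          * 2 ^ ((Fintype.card L - 1).primeFactors \ S).card
        + (1 - ∑ p ∈ S, (p : ℝ)⁻¹) * (2 ^ ((Fintype.card L - 1).primeFactors \ S).card - 1)
        < (1 - ∑ p ∈ S, (p : ℝ)⁻¹) * R) → ∃ α : L, IsPrimitiveElement α ∧ T α = b := by
    rintro ⟨S, hS, hδ, h⟩
    exact exists_isPrimitiveElement_of_sieve T hT hb hR0 hR S hS hδ h
  have small : ∀ (N t : ℕ), Fintype.card L - 1 = N → N.primeFactors.card ≤ t →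
      (2 ^ t - 1) ^ 2 < (q ^ D) ^ m → ∃ α : L, IsPrimitiveElement α ∧ T α = b := by
    intro N t hN ht hlt'
    refine main ?_
    rw [hN]
    refine sieve_condition_of_card_primeFactors_le ht ?_
    have := hlt hlt'
    rw [Nat.cast_sub Nat.one_le_two_pow] at this
    exact_mod_cast this
  by_cases hbig : 54756 ≤ (q ^ D) ^ m
  · refine main (sieve_condition_of_large ?_ ?_ ?_)
    · have := Fintype.one_lt_card (α := L)
      omega
    · rw [hRdef]
      refine Real.le_sqrt_of_sq_le ?_
      have : (54756 : ℝ) ≤ ((q ^ D) ^ m : ℕ) := by exact_mod_cast hbig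
      linarith
    · have h1 : R ^ 4 = (((q ^ D) ^ (m * 2) : ℕ) : ℝ) := by
        rw [show R ^ 4 = (R ^ 2) ^ 2 by ring, hRsq]
        push_cast
        rw [← pow_mul]
      rw [h1]
      -- After the shift of `m`, `L` has degree `m + 1 ≤ 2 * m` over `E`, so its size is at most `R
      -- ^ 4`.
      have h2 : (q ^ D) ^ (m + 1) ≤ (q ^ D) ^ (m * 2) :=
        Nat.pow_le_pow_right (by omega) (by omega)
      have h3 : Fintype.card L - 1 ≤ (q ^ D) ^ (m * 2) := by omega
      exact_mod_cast h3
  · push Not at hbig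
    have hm3 : m < 3 := by
      by_contra! hle
      have h1 : 64 ^ 3 ≤ (q ^ D) ^ m := (Nat.pow_le_pow_right (by norm_num) hle).trans
        (Nat.pow_le_pow_left h64 m)
      norm_num at h1
      omega
    have hQ : q ^ D < 54756 := by
      refine lt_of_le_of_lt ?_ hbig
      exact Nat.le_self_pow (by omega) _
    have hm12 : m = 1 ∨ m = 2 := by omega
    rcases hm12 with rfl | rfl
    · rw [pow_one] at hbig small
      rcases eq_or_eq_of_pow_lt hq hD6 hD hQ with ⟨rfl, h⟩ | ⟨rfl, h⟩
      · simp only [Finset.mem_insert, Finset.mem_singleton] at h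
        rcases h with rfl | rfl | rfl | rfl | rfl
        · exact exists_isPrimitiveElement_of_card_eq_64 T hT hb (by rw [hE]; norm_num)
            (by rw [hL]; norm_num)
        · refine main ?_
          have hN : Fintype.card L - 1 = 531440 := by rw [hL]; norm_num
          rw [hN]
          refine sieve_condition_of_eq_531440 ?_
          rw [hRdef, Real.sqrt_eq_iff_eq_sq (by positivity) (by norm_num)]
          norm_num
        · exact small 16777215 6 (by rw [hL]; norm_num) (by decide +kernel) (by norm_num)
        · exact small 244140624 6 (by rw [hL]; norm_num) (by decide +kernel) (by norm_num)
        · exact small 2176782335 7 (by rw [hL]; norm_num) (by decide +kernel) (by norm_num)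
      · simp only [Finset.mem_insert, Finset.mem_singleton] at h
        rcases h with rfl | rfl | rfl | rfl
        · exact small 1048575 5 (by rw [hL]; norm_num) (by decide +kernel) (by norm_num)
        · exact small 16777215 6 (by rw [hL]; norm_num) (by decide +kernel) (by norm_num)
        · exact small 268435455 6 (by rw [hL]; norm_num) (by decide +kernel) (by norm_num)
        · exact small 1073741823 6 (by rw [hL]; norm_num) (by decide +kernel) (by norm_num)
    · have hQ' : q ^ D < 234 := by
        by_contra! hle
        have := Nat.pow_le_pow_left hle 2
        norm_num at this
        omega
      rcases eq_or_eq_of_pow_lt hq hD6 hD hQ with ⟨rfl, h⟩ | ⟨rfl, h⟩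
      · simp only [Finset.mem_insert, Finset.mem_singleton] at h
        rcases h with rfl | rfl | rfl | rfl | rfl
        · exact small 262143 4 (by rw [hL]; norm_num) (by decide +kernel) (by norm_num)
        all_goals norm_num at hQ'
      · simp only [Finset.mem_insert, Finset.mem_singleton] at h
        rcases h with rfl | rfl | rfl | rfl <;> norm_num at hQ'

/-! ### Gluing functionals on kernels of polynomials in one endomorphism -/

section kernels

open Polynomial

variable {K V : Type*} [Field K] [AddCommGroup V] [Module K V] (φ : Module.End K V)

/-- Here `l` is a least common multiple, and Bézout's identity divided by the gcd gives `A + B = 1`.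
Evaluated at an endomorphism, `A` and `B` split the kernel of `l` into the kernels of `f` and `g`.
-/
theorem Polynomial.exists_lcm_splitting (f : K[X]) {g : K[X]} (hg : g ≠ 0) :
    ∃ l A B : K[X], f ∣ l ∧ g ∣ l ∧ A + B = 1 ∧ l ∣ f * A ∧ l ∣ g * B := by
  classical
  obtain ⟨f', hf'⟩ := EuclideanDomain.gcd_dvd_left f g
  obtain ⟨g', hg'⟩ := EuclideanDomain.gcd_dvd_right f g
  have he : EuclideanDomain.gcd f g ≠ 0 := fun h => hg (EuclideanDomain.gcd_eq_zero_iff.1 h).2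
  have hbez := EuclideanDomain.gcd_eq_gcd_ab f g
  set e := EuclideanDomain.gcd f g
  set u := EuclideanDomain.gcdA f g
  set v := EuclideanDomain.gcdB f g
  refine ⟨e * f' * g', g' * v, f' * u, ⟨g', by rw [hf']⟩, ⟨f', ?_⟩, ?_, ⟨v, ?_⟩, ⟨u, ?_⟩⟩
  · linear_combination (-f') * hg'
  · apply mul_left_cancel₀ he
    linear_combination -hbez - u * hf' - v * hg'
  · linear_combination (g' * v) * hf'
  · linear_combination (f' * u) * hg'

theorem Polynomial.aeval_apply_eq_zero_of_dvd {p r : K[X]} (h : p ∣ r) {x : V}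
    (hx : aeval φ p x = 0) : aeval φ r x = 0 := by
  obtain ⟨c, rfl⟩ := h
  rw [mul_comm, map_mul, Module.End.mul_apply, hx, map_zero]

/-- Functionals on the kernels of finitely many polynomials in one endomorphism that agree on the
pairwise intersections have a common extension: these kernels generate a distributive lattice. -/
theorem exists_functional_of_compatible {ι : Type*} (f : ι → K[X]) (hf : ∀ i, f i ≠ 0)
    (ℓ : ι → V →ₗ[K] K)
    (hℓ : ∀ i j v, aeval φ (f i) v = 0 → aeval φ (f j) v = 0 → ℓ i v = ℓ j v) (s : Finset ι) :
    ∃ P : K[X], ∃ g : V →ₗ[K] K, (∀ i ∈ s, f i ∣ P) ∧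
      (∀ (h : K[X]) (W : Submodule K V),
        (∀ i ∈ s, ∀ v, aeval φ (f i) v = 0 → aeval φ h v = 0 → v ∈ W) →
        ∀ v, aeval φ P v = 0 → aeval φ h v = 0 → v ∈ W) ∧
      ∀ i ∈ s, ∀ v, aeval φ (f i) v = 0 → g v = ℓ i v := by
  classical
  induction s using Finset.induction_on with
  | empty =>
    -- The second clause of the claim is distributivity: the kernel of `P` meets that of any `h`
    -- inside the sum of the intersections with the kernels of the `f i`. Keeping `h` arbitrary lets
    -- the induction run.
    refine ⟨1, 0, by simp, fun h W _ v hv _ => ?_, by simp⟩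
    rw [map_one, Module.End.one_apply] at hv
    rw [hv]
    exact W.zero_mem
  | insert i₀ s _ ih =>
    obtain ⟨P, g, hP, hW, hg⟩ := ih
    obtain ⟨l, A, B, hPl, hfl, hAB, hA, hB⟩ := Polynomial.exists_lcm_splitting P (hf i₀)
    have hdec : ∀ x, aeval φ A x + aeval φ B x = x := fun x => by
      rw [← LinearMap.add_apply, ← map_add, hAB, map_one, Module.End.one_apply]
    have hAl : ∀ x, aeval φ l x = 0 → aeval φ P (aeval φ A x) = 0 := fun x hx => by
      rw [← Module.End.mul_apply, ← map_mul]
      exact aeval_apply_eq_zero_of_dvd φ hA hx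
    have hBl : ∀ x, aeval φ l x = 0 → aeval φ (f i₀) (aeval φ B x) = 0 := fun x hx => by
      rw [← Module.End.mul_apply, ← map_mul]
      exact aeval_apply_eq_zero_of_dvd φ hB hx
    have hcomm : ∀ (p r : K[X]) (x : V), aeval φ p x = 0 → aeval φ p (aeval φ r x) = 0 := by
      intro p r x hx
      rw [← Module.End.mul_apply, ← map_mul]
      exact aeval_apply_eq_zero_of_dvd φ (dvd_mul_right p r) hx
    -- Distributivity with `h = f i₀` reduces agreement on this intersection to the pairwise
    -- hypothesis.
    have hagree : ∀ v, aeval φ P v = 0 → aeval φ (f i₀) v = 0 → g v = ℓ i₀ v := by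
      intro v hv hv'
      have := hW (f i₀) (LinearMap.ker (g - ℓ i₀)) (fun i hi w hw hw' => by
        rw [LinearMap.mem_ker, LinearMap.sub_apply, hg i hi w hw, hℓ i i₀ w hw hw', sub_self])
        v hv hv'
      rwa [LinearMap.mem_ker, LinearMap.sub_apply, sub_eq_zero] at this
    have hgP : ∀ v, aeval φ P v = 0 → g (aeval φ A v) + ℓ i₀ (aeval φ B v) = g v := by
      intro v hv
      rw [← hagree _ (hcomm P B v hv) (hBl v (aeval_apply_eq_zero_of_dvd φ hPl hv)), ← map_add,
        hdec]
    refine ⟨l, g ∘ₗ aeval φ A + ℓ i₀ ∘ₗ aeval φ B, ?_, ?_, ?_⟩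
    · intro i hi
      rcases Finset.mem_insert.1 hi with rfl | hi
      · exact hfl
      · exact (hP i hi).trans hPl
    · intro h W hWs v hv hv'
      rw [← hdec v]
      refine W.add_mem (hW h W (fun i hi => hWs i (Finset.mem_insert_of_mem hi)) _ (hAl v hv)
        (hcomm h A v hv')) (hWs i₀ (Finset.mem_insert_self _ _) _ (hBl v hv) (hcomm h B v hv'))
    · intro i hi v hv
      rw [LinearMap.add_apply, LinearMap.comp_apply, LinearMap.comp_apply]
      rcases Finset.mem_insert.1 hi with rfl | hi
      · rw [hagree _ (hAl v (aeval_apply_eq_zero_of_dvd φ hfl hv)) (hcomm _ A v hv), ← map_add,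
          hdec]
      · rw [hgP v (aeval_apply_eq_zero_of_dvd φ (hP i hi) hv), hg i hi v hv]

theorem Polynomial.aeval_apply_of_intertwine {U : Type*} [AddCommGroup U] [Module K U]
    (ψ : Module.End K U) (ι : U →ₗ[K] V) (h : ∀ x, ι (ψ x) = φ (ι x)) (p : K[X]) (x : U) :
    ι (aeval ψ p x) = aeval φ p (ι x) := by
  induction p using Polynomial.induction_on generalizing x with
  | C a => simp [Module.algebraMap_end_apply]
  | add p r hp hr => simp [hp, hr]
  | monomial n a ih =>
    rw [pow_succ, ← mul_assoc, map_mul (aeval ψ) (C a * X ^ n), map_mul (aeval φ) (C a * X ^ n),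
      Module.End.mul_apply, Module.End.mul_apply, aeval_X, aeval_X, ih, h]

end kernels

/-! ### Subfields as kernels of polynomials in Frobenius -/

section frobenius

open FiniteField Polynomial

variable {K L : Type*} [Field K] [Fintype K] [Field L] [Finite L] [Algebra K L]

theorem frobenius_toLinearMap_pow_apply (d : ℕ) (x : L) :
    ((frobeniusAlgEquivOfAlgebraic K L).toLinearMap ^ d) x = x ^ Fintype.card K ^ d := by
  rw [Module.End.pow_apply]
  exact congrFun (coe_frobeniusAlgEquivOfAlgebraic_iterate K L d) x

theorem aeval_frobenius_X_pow_sub_one_eq_zero_iff (d : ℕ) (x : L) :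
    aeval (frobeniusAlgEquivOfAlgebraic K L).toLinearMap (X ^ d - 1 : K[X]) x = 0
      ↔ x ^ Fintype.card K ^ d = x := by
  rw [map_sub, map_pow, aeval_X, map_one, LinearMap.sub_apply, Module.End.one_apply,
    frobenius_toLinearMap_pow_apply, sub_eq_zero]

theorem IntermediateField.mem_iff_pow_card_pow_eq (F : IntermediateField K L) (x : L) :
    x ∈ F ↔ x ^ Fintype.card K ^ Module.finrank K F = x := by
  have := Fintype.ofFinite F
  rw [← Module.card_eq_pow_finrank (K := K) (V := F)]
  constructor
  · intro hx
    exact congrArg Subtype.val (FiniteField.pow_card (⟨x, hx⟩ : F))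
  · intro hx
    obtain ⟨y, rfl⟩ := mem_range_algebraMap_of_pow_card_eq (E := F) hx
    exact y.2

theorem IntermediateField.mem_iff_aeval_frobenius (F : IntermediateField K L) (x : L) :
    x ∈ F ↔ aeval (frobeniusAlgEquivOfAlgebraic K L).toLinearMap
      (X ^ Module.finrank K F - 1 : K[X]) x = 0 := by
  rw [aeval_frobenius_X_pow_sub_one_eq_zero_iff, F.mem_iff_pow_card_pow_eq]

/-- A finite field is not the sum of its proper subfields. -/
theorem exists_mem_notMem_iSup_toSubmodule {ι : Type*} [Nonempty ι] (E : IntermediateField K L)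
    (F : ι → IntermediateField K L)
    (h : ∀ i, Module.finrank K (F i) ∈ (Module.finrank K E).properDivisors) :
    ∃ x ∈ E, x ∉ ⨆ i, Subalgebra.toSubmodule (F i).toSubalgebra := by
  by_contra! hE
  set D := Module.finrank K E with hD
  have hcyc : cyclotomic D K ≠ 0 := cyclotomic_ne_zero D K
  obtain ⟨i₀⟩ := ‹Nonempty ι›
  -- `G` is `(X ^ D - 1) / Φ_D`. Every `X ^ d - 1` with `d` a proper divisor of `D` divides it, so
  -- it kills the sum of the subfields.
  obtain ⟨G, hG⟩ : ∃ G : K[X], X ^ D - 1 = G * cyclotomic D K := by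
    obtain ⟨c, hc⟩ := X_pow_sub_one_mul_cyclotomic_dvd_X_pow_sub_one_of_dvd K (h i₀)
    exact ⟨(X ^ Module.finrank K (F i₀) - 1) * c, by rw [hc]; ring⟩
  have hDpos : 0 < D := Module.finrank_pos
  have hG0 : G ≠ 0 := by
    rintro rfl
    rw [zero_mul] at hG
    exact X_pow_sub_C_ne_zero hDpos (1 : K) (by simpa using hG)
  have hdvd : ∀ i, (X ^ Module.finrank K (F i) - 1 : K[X]) ∣ G := by
    intro i
    have h1 := X_pow_sub_one_mul_cyclotomic_dvd_X_pow_sub_one_of_dvd K (h i)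
    rw [hG] at h1
    exact (mul_dvd_mul_iff_right hcyc).1 h1
  have hker : ∀ x ∈ E, aeval (frobeniusAlgEquivOfAlgebraic K L).toLinearMap G x = 0 := by
    intro x hx
    have hle : (⨆ i, Subalgebra.toSubmodule (F i).toSubalgebra)
        ≤ LinearMap.ker (aeval (frobeniusAlgEquivOfAlgebraic K L).toLinearMap G) := by
      refine iSup_le fun i y hy => ?_
      exact aeval_apply_eq_zero_of_dvd _ (hdvd i) (((F i).mem_iff_aeval_frobenius y).1 hy)
    exact hle (hE x hx)
  have hE0 : aeval (frobeniusAlgEquivOfAlgebraic K E).toLinearMap G = 0 := by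
    ext x
    have := aeval_apply_of_intertwine (frobeniusAlgEquivOfAlgebraic K L).toLinearMap
      (frobeniusAlgEquivOfAlgebraic K E).toLinearMap E.val.toLinearMap (fun y => rfl) G x
    exact this.trans (hker x x.2)
  -- Frobenius on `E` has minimal polynomial `X ^ D - 1`, which cannot divide the nonzero `G` of
  -- smaller degree.
  have hmin := minpoly.dvd K _ hE0
  rw [minpoly_algEquiv_toLinearMap _ (isOfFinOrder_of_finite _),
    orderOf_frobeniusAlgEquivOfAlgebraic, map_one] at hmin
  have hdeg := natDegree_le_of_dvd hmin hG0
  rw [← hD, hG, natDegree_mul hG0 hcyc, natDegree_cyclotomic] at hdeg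
  have := Nat.totient_pos.2 hDpos
  omega

end frobenius

/-! ### Compatible traces and trace duality -/

section traces

open FiniteField

theorem Finset.sum_range_mul_eq {M : Type*} [AddCommMonoid M] (f : ℕ → M) (g m : ℕ) :
    ∑ l ∈ Finset.range (g * m), f l
      = ∑ r ∈ Finset.range g, ∑ t ∈ Finset.range m, f (g * t + r) := by
  rw [Finset.sum_comm]
  induction m with
  | zero => simp
  | succ m ih => rw [Nat.mul_succ, Finset.sum_range_add, ih, Finset.sum_range_succ]

theorem pow_card_pow_gcd_eq {L : Type*} [Monoid L] {q d e : ℕ} {v : L} (hd : v ^ q ^ d = v) (he : v ^ q ^ e = v) :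
    v ^ q ^ Nat.gcd d e = v := by
  have h1 : ∀ m, Function.IsPeriodicPt (fun x : L => x ^ q) m v ↔ v ^ q ^ m = v := by
    intro m
    rw [Function.IsPeriodicPt, Function.IsFixedPt, pow_iterate]
  exact (h1 _).1 (((h1 d).2 hd).gcd ((h1 e).2 he))

theorem trace_mul_eq_trace_trace_mul {K L : Type*} [Field K] [Field L] [Finite L] [Algebra K L]
    (F : IntermediateField K L) (x : L) (v : F) :
    Algebra.trace K L (x * v) = Algebra.trace K F (Algebra.trace F L x * v) := by
  have h : x * (v : L) = v • x := by rw [Algebra.smul_def, mul_comm]; rfl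
  rw [← Algebra.trace_trace (S := F), h, map_smul, smul_eq_mul, mul_comm]

variable {K L : Type*} [Field K] [Fintype K] [Field L] [Finite L] [Algebra K L]

/-- Transitivity of the trace at the level of power sums: write `l = g * t + r` and use that `v` is
fixed by the `g`-th power of Frobenius. -/
theorem sum_mul_pow_eq_sum_traceSum (a v : L) {d g : ℕ} (hgd : g ∣ d)
    (hv : v ^ Fintype.card K ^ g = v) :
    ∑ l ∈ Finset.range d, (a * v) ^ Fintype.card K ^ l
      = ∑ r ∈ Finset.range g, (traceSum (Fintype.card K) d g a * v) ^ Fintype.card K ^ r := by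
  obtain ⟨m, rfl⟩ := hgd
  rcases g.eq_zero_or_pos with rfl | hg
  · simp
  have hvt : ∀ t, v ^ Fintype.card K ^ (g * t) = v := by
    intro t
    rw [pow_mul]
    exact (congrFun (pow_iterate (Fintype.card K ^ g) t) v).symm.trans (Function.iterate_fixed hv t)
  have hadd : ∀ (r : ℕ) (x : L), x ^ Fintype.card K ^ r
      = ((frobeniusAlgEquivOfAlgebraic K L).toLinearMap ^ r) x :=
    fun r x => (frobenius_toLinearMap_pow_apply r x).symm
  rw [Finset.sum_range_mul_eq]
  refine Finset.sum_congr rfl fun r _ => ?_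
  rw [traceSum, Nat.mul_div_cancel_left _ hg, Finset.sum_mul, hadd r, map_sum]
  refine Finset.sum_congr rfl fun t _ => ?_
  rw [← hadd r, pow_add, pow_mul, mul_pow, hvt]

theorem algebraMap_trace_eq_traceSum (F : IntermediateField K L) (x : L) :
    (algebraMap F L) (Algebra.trace F L x)
      = traceSum (Fintype.card K) (Module.finrank K L) (Module.finrank K F) x := by
  rw [algebraMap_trace_eq_sum_pow, traceSum, Module.natCard_eq_pow_finrank (K := K),
    Nat.card_eq_fintype_card, ← Module.finrank_mul_finrank K F L,
    Nat.mul_div_cancel_left _ Module.finrank_pos]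
  simp_rw [pow_mul]

theorem algebraMap_trace_eq_sum_frobenius (F : IntermediateField K L) (x : F) :
    (algebraMap K L) (Algebra.trace K F x)
      = ∑ l ∈ Finset.range (Module.finrank K F), (x : L) ^ Fintype.card K ^ l := by
  have h := congrArg (algebraMap F L) (algebraMap_trace_eq_sum_pow K F x)
  rw [← IsScalarTower.algebraMap_apply, map_sum, Nat.card_eq_fintype_card] at h
  simp only [map_pow] at h
  exact h

/-- Elements of subfields with compatible traces define functionals that agree on intersections. -/
theorem trace_mul_eq_of_traceSum_eq (F G : IntermediateField K L) (a : F) (b : G)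
    (h : traceSum (Fintype.card K) (Module.finrank K F)
        (Nat.gcd (Module.finrank K F) (Module.finrank K G)) (a : L)
      = traceSum (Fintype.card K) (Module.finrank K G)
        (Nat.gcd (Module.finrank K F) (Module.finrank K G)) (b : L))
    {v : L} (hF : v ∈ F) (hG : v ∈ G) :
    Algebra.trace K F (a * ⟨v, hF⟩) = Algebra.trace K G (b * ⟨v, hG⟩) := by
  apply (algebraMap K L).injective
  have hv := pow_card_pow_gcd_eq ((F.mem_iff_pow_card_pow_eq v).1 hF)
    ((G.mem_iff_pow_card_pow_eq v).1 hG)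
  rw [algebraMap_trace_eq_sum_frobenius, algebraMap_trace_eq_sum_frobenius]
  exact (sum_mul_pow_eq_sum_traceSum (a : L) v (Nat.gcd_dvd_left _ _) hv).trans
    ((congrArg (fun y => ∑ r ∈ Finset.range (Nat.gcd (Module.finrank K F) (Module.finrank K G)),
      (y * v) ^ Fintype.card K ^ r) h).trans (sum_mul_pow_eq_sum_traceSum (b : L) v (Nat.gcd_dvd_right _ _) hv).symm)

theorem eq_of_forall_trace_mul_eq {F : Type*} [Field F] [Algebra K F] [Finite F] {x y : F}
    (h : ∀ v, Algebra.trace K F (x * v) = Algebra.trace K F (y * v)) : x = y := by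
  rw [← sub_eq_zero]
  refine (traceForm_nondegenerate K F).1 _ fun v => ?_
  rw [Algebra.traceForm_apply, sub_mul, map_sub, h, sub_self]

/-- Compatible traces on pairwise incomparable subfields come from a nonzero element of any larger
subfield `E`: every element whose trace to `E` is that element has the prescribed traces. -/
theorem exists_ne_zero_of_compatible_traces {ι : Type*} [Fintype ι] [Nonempty ι]
    (E : IntermediateField K L) (F : ι → IntermediateField K L) (hFE : ∀ i, F i ≤ E)
    (hprop : ∀ i, Module.finrank K (F i) ∈ (Module.finrank K E).properDivisors) (a : ∀ i, F i)
    (ha : ∀ i j, i ≠ j → traceSum (Fintype.card K) (Module.finrank K (F i))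
        (Nat.gcd (Module.finrank K (F i)) (Module.finrank K (F j))) (a i : L)
      = traceSum (Fintype.card K) (Module.finrank K (F j))
        (Nat.gcd (Module.finrank K (F i)) (Module.finrank K (F j))) (a j : L)) :
    ∃ b : E, b ≠ 0 ∧ ∀ α : L, Algebra.trace E L α = b → ∀ i, Algebra.trace (F i) L α = a i := by
  classical
  -- Gluing needs functionals on all of `L`, so each `a i` is lifted through the surjective trace;
  -- on `F i` the lifted functional depends only on `a i`.
  have hlift : ∀ i, ∃ x : L, Algebra.trace (F i) L x = a i :=
    fun i => Algebra.trace_surjective (F i) L (a i)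
  choose x hx using hlift
  have hℓ : ∀ i (v : F i), Algebra.trace K L (x i * v) = Algebra.trace K (F i) (a i * v) := by
    intro i v
    rw [trace_mul_eq_trace_trace_mul, hx]
  obtain ⟨-, g, -, -, hg⟩ := exists_functional_of_compatible
    (frobeniusAlgEquivOfAlgebraic K L).toLinearMap
    (fun i => (Polynomial.X ^ Module.finrank K (F i) - 1 : Polynomial K))
    (fun i => by
      simpa using Polynomial.X_pow_sub_C_ne_zero (Module.finrank_pos (R := K) (M := F i)) (1 : K))
    (fun i => Algebra.traceForm K L (x i)) (by
      intro i j v hi hj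
      rw [← IntermediateField.mem_iff_aeval_frobenius] at hi hj
      rcases eq_or_ne i j with rfl | hij
      · rfl
      · rw [Algebra.traceForm_apply, Algebra.traceForm_apply, hℓ i ⟨v, hi⟩, hℓ j ⟨v, hj⟩]
        exact trace_mul_eq_of_traceSum_eq _ _ _ _ (ha i j hij) hi hj) Finset.univ
  have hgv : ∀ i (v : F i), g v = Algebra.trace K (F i) (a i * v) := fun i v => by
    rw [hg i (Finset.mem_univ i) v ((IntermediateField.mem_iff_aeval_frobenius _ _).1 v.2),
      Algebra.traceForm_apply, hℓ]
  obtain ⟨w, hwE, hw⟩ := exists_mem_notMem_iSup_toSubmodule E F hprop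
  obtain ⟨h, hhE, hh⟩ : ∃ h : L →ₗ[K] K, h w ≠ 0 ∧
      ∀ i (v : F i), h v = Algebra.trace K (F i) (a i * v) := by
    -- If `g` vanishes at `w`, adding a functional that kills every `F i` but not `w` repairs this.
    by_cases hgw : g w = 0
    · obtain ⟨k, hkw, hk⟩ := Submodule.exists_le_ker_of_notMem hw
      refine ⟨g + k, by simpa [hgw] using hkw, fun i v => ?_⟩
      have hkv : k v = 0 := hk (Submodule.mem_iSup_of_mem i v.2)
      rw [LinearMap.add_apply, hgv, hkv, add_zero]
    · exact ⟨g, hgw, hgv⟩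
  -- Nondegeneracy of the trace form represents the restriction of `h` to `E`; as `h w ≠ 0` with `w`
  -- in `E`, the representing element is nonzero.
  set b : E := ((Algebra.traceForm K E).toDual (traceForm_nondegenerate K E)).symm
    (h ∘ₗ E.val.toLinearMap) with hb
  have hbv : ∀ v : E, Algebra.trace K E (b * v) = h v := fun v =>
    LinearMap.BilinForm.apply_toDual_symm_apply (hB := traceForm_nondegenerate K E) _ v
  refine ⟨b, ?_, fun α hα i => eq_of_forall_trace_mul_eq (K := K) fun v => ?_⟩
  · intro h0
    refine hhE ?_
    rw [← hbv ⟨w, hwE⟩, h0, zero_mul, map_zero]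
  · rw [← trace_mul_eq_trace_trace_mul, ← hh i v]
    have := trace_mul_eq_trace_trace_mul E α ⟨v, hFE i v.2⟩
    rw [hα, hbv] at this
    exact this

/-- Subfields of degrees with a least common multiple below `[L : K]` lie in a proper subfield. -/
theorem exists_ne_top_of_lcm_lt {ι : Type*} [Fintype ι] (F : ι → IntermediateField K L)
    (h : (Finset.univ.lcm fun i => Module.finrank K (F i)) < Module.finrank K L) :
    ∃ E : IntermediateField K L, E ≠ ⊤ ∧ ∀ i, F i ≤ E := by
  set D := Finset.univ.lcm fun i => Module.finrank K (F i)
  set σ := frobeniusAlgEquivOfAlgebraic K L ^ D with hσ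
  refine ⟨IntermediateField.fixedField (Subgroup.zpowers σ), ?_, fun i x hx => ?_⟩
  · intro htop
    -- If the fixed field were everything, the order `[L : K]` of Frobenius would divide `D`, which
    -- is positive and smaller.
    have h1 : σ = 1 := by
      ext x
      have hx : x ∈ IntermediateField.fixedField (Subgroup.zpowers σ) := htop ▸ trivial
      exact (IntermediateField.mem_fixedField_iff _ x).1 hx σ (Subgroup.mem_zpowers σ)
    have h2 := orderOf_dvd_of_pow_eq_one h1
    rw [orderOf_frobeniusAlgEquivOfAlgebraic] at h2
    have hD : D ≠ 0 := by
      intro h0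
      obtain ⟨i, -, hi⟩ := Finset.lcm_eq_zero_iff.1 h0
      exact Module.finrank_pos.ne' hi
    exact absurd (Nat.le_of_dvd (Nat.pos_of_ne_zero hD) h2) (not_le.2 h)
  · rw [IntermediateField.mem_fixedField_iff]
    have hσx : σ x = x := by
      obtain ⟨t, ht⟩ : Module.finrank K (F i) ∣ D := Finset.dvd_lcm (Finset.mem_univ i)
      rw [hσ, ht, pow_mul, AlgEquiv.coe_pow]
      refine Function.iterate_fixed ?_ t
      rw [AlgEquiv.coe_pow, coe_frobeniusAlgEquivOfAlgebraic_iterate]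
      exact ((F i).mem_iff_pow_card_pow_eq x).1 hx
    have hle : Subgroup.zpowers σ ≤ MulAction.stabilizer (L ≃ₐ[K] L) x :=
      Subgroup.zpowers_le.2 hσx
    exact fun f hf => hle hf

end traces

/-! ### Conclusion -/

/-- The divisors of a prime power form a chain. -/
theorem not_isPrimePow_of_dvd {D d e : ℕ} (hd : d ∣ D) (he : e ∣ D) (hde : ¬ d ∣ e)
    (hed : ¬ e ∣ d) : ¬ IsPrimePow D := by
  rw [isPrimePow_nat_iff]
  rintro ⟨p, k, hp, -, rfl⟩
  obtain ⟨i, -, rfl⟩ := (Nat.dvd_prime_pow hp).1 hd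
  obtain ⟨j, -, rfl⟩ := (Nat.dvd_prime_pow hp).1 he
  rcases le_total i j with h | h
  · exact hde (pow_dvd_pow p h)
  · exact hed (pow_dvd_pow p h)

theorem six_le_of_not_isPrimePow {D : ℕ} (h1 : 1 < D) (hD : ¬ IsPrimePow D) : 6 ≤ D := by
  by_contra! h
  interval_cases D
  · exact hD Nat.prime_two.isPrimePow
  · exact hD Nat.prime_three.isPrimePow
  · exact hD (by simpa using Nat.prime_two.isPrimePow.pow two_ne_zero)
  · exact hD Nat.prime_five.isPrimePow

theorem theorem3 {K L : Type*} [Field K] [Finite K] [Field L] [Algebra K L]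
    (q n k : ℕ) (hq : Nat.card K = q) (hL : Module.finrank K L = n)
    (hn : 1 < n) (hnpp : ¬ IsPrimePow n) (hk : 1 < k) (hkn : k < n.divisors.card)
    (d : Fin k → ℕ) (hd : d ∈ divisorTuples k n)
    (F : Fin k → IntermediateField K L) (hF : ∀ i, Module.finrank K (F i) = d i)
    (a : (i : Fin k) → F i) (ha : IsAdmissible q d (fun i => (a i : L)))
    (hlcm : Finset.univ.lcm d < n) :
    ∃ α : L, IsPrimitiveElement α ∧ ∀ i, traceSum q n (d i) α = (a i : L) := by
  have := Fintype.ofFinite K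
  have : FiniteDimensional K L := Module.finite_of_finrank_pos (by omega)
  have : Finite L := Module.finite_of_finite K
  rw [Nat.card_eq_fintype_card] at hq
  obtain rfl : d = fun i => Module.finrank K (F i) := funext fun i => (hF i).symm
  subst hq hL
  obtain ⟨-, -, hinc⟩ := hd
  obtain ⟨E, hEtop, hFE⟩ := exists_ne_top_of_lcm_lt F hlcm
  have hdvd : ∀ i, Module.finrank K (F i) ∣ Module.finrank K E :=
    fun i => IntermediateField.finrank_dvd_of_le_right (hFE i)
  have : Nonempty (Fin k) := ⟨⟨0, by omega⟩⟩
  have : Nontrivial (Fin k) := Fin.nontrivial_iff_two_le.2 hk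
  have hprop : ∀ i, Module.finrank K (F i) ∈ (Module.finrank K E).properDivisors := by
    intro i
    refine Nat.mem_properDivisors.2 ⟨hdvd i, lt_of_le_of_ne
      (Nat.le_of_dvd Module.finrank_pos (hdvd i)) fun h => ?_⟩
    -- If `F i` had the full degree of `E`, every other `d j` would divide `d i`; this uses `k > 1`.
    obtain ⟨j, hj⟩ := exists_ne i
    have hji := hdvd j
    rw [← h] at hji
    exact hinc j i hj hji
  obtain ⟨b, hb, hbα⟩ := exists_ne_zero_of_compatible_traces E F hFE hprop a (by
    intro i j hij
    rcases lt_or_gt_of_ne hij with h | h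
    · exact ha i j h
    · have := (ha j i h).symm
      rwa [Nat.gcd_comm] at this)
  obtain ⟨i, j, hij⟩ := exists_pair_ne (Fin k)
  have hD := not_isPrimePow_of_dvd (hdvd i) (hdvd j) (hinc i j hij) (hinc j i hij.symm)
  have hD1 : 1 < Module.finrank K E :=
    lt_of_le_of_lt Module.finrank_pos (Nat.mem_properDivisors.1 (hprop i)).2
  have hm1 : Module.finrank E L ≠ 1 := fun h =>
    hEtop (IntermediateField.finrank_eq_one_iff_eq_top.1 h)
  have hm0 : 0 < Module.finrank E L := Module.finrank_pos
  have hcardE : Nat.card E = Fintype.card K ^ Module.finrank K E := by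
    rw [Module.natCard_eq_pow_finrank (K := K), Nat.card_eq_fintype_card]
  obtain ⟨α, hα, htr⟩ := exists_isPrimitiveElement_of_ne_zero (Algebra.trace E L)
    (Algebra.trace_surjective E L) hb (q := Fintype.card K) (D := Module.finrank K E)
    (m := Module.finrank E L) Fintype.one_lt_card (six_le_of_not_isPrimePow hD1 hD) hD (by omega)
    hcardE (by rw [Module.natCard_eq_pow_finrank (K := E), hcardE])
  refine ⟨α, hα, fun i => ?_⟩
  rw [← algebraMap_trace_eq_traceSum, hbα α htr i]
  rfl
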